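/- Let $\mu$ be a positive, finite, compactly supported Borel measure on $\mathbb{R}^2$ with $\mu(\mathbb{R}^2)>0$, let $\lambda>0$ and let $p\ge 1$ be real. If $p<2$, assume in addition that $\mu$ is absolutely continuous with respect to Lebesgue measure and that its density is (essentially) bounded. Let $\mathcal{C}$ be the class of all curves $\gamma:[0,a]\to\mathbb{R}^2$, with any $a\ge 0$, that are Lipschitz and satisfy $|\gamma'|\le 1$ almost everywhere. For $\gamma\in\mathcal{C}$ put $\Gamma_\gamma=\gamma([0,a])$, let $L(\gamma)$ be the length of $\gamma$, i.e. its total variation on $[0,a]$, and let $$E_\mu^{\lambda,p}(\gamma)=\int_{\mathbb{R}^2} d(x,\Gamma_\gamma)^p\,d\mu(x)+\lambda\,L(\gamma),\qquad d(x,\Gamma_\gamma)=\inf_{y\in\Gamma_\gamma}|x-y|.$$ Let $\gamma:[0,L]\to\mathbb{R}^2$ be a minimizer of $E_\mu^{\lambda,p}$ over $\mathcal{C}$ that is parameterized by arc length, i.e. for all $0\le s\le t\le L$ the total variation of $\gamma$ on $[s,t]$ equals $t-s$. Then $\gamma$ is injective on $[0,L]$; in particular $\gamma$ is a homeomorphism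 of $[0,L]$ onto $\Gamma_\gamma$, so $\Gamma_\gamma$ is a curve embedded in $\mathbb{R}^2$ (a single point if $L=0$). -/

import Mathlib

open Set MeasureTheory

open scoped NNReal ENNReal

/-- `𝓜`: positive, finite, compactly supported Borel measures on `ℝᵈ` with `μ(ℝᵈ) > 0`. -/
structure IsDataMeasure {d : ℕ} (μ : Measure (EuclideanSpace ℝ (Fin d))) : Prop where
  finite : IsFiniteMeasure μ
  isCompact_support : IsCompact μ.support
  pos : 0 < μ univ

/-- `γ : [0,a] → ℝᵈ` belongs to the class `𝓒`: `a ≥ 0`, `γ` is Lipschitz on `[0,a]`, and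
`|γ'| ≤ 1` a.e. on `[0,a]`. A curve on `[0,a]` is represented by a function on `ℝ`; only its
values on `[0,a]` matter. The derivative is taken at interior points, and exists at almost all of
them because `γ` is Lipschitz. -/
structure IsAdmissibleCurve {d : ℕ} (a : ℝ) (γ : ℝ → EuclideanSpace ℝ (Fin d)) : Prop where
  nonneg : 0 ≤ a
  lipschitz : ∃ K : ℝ≥0, LipschitzOnWith K γ (Icc 0 a)
  norm_deriv_le : ∀ᵐ t ∂(volume : Measure ℝ), t ∈ Ioo 0 a → ‖deriv γ t‖ ≤ 1

/-- The length of `γ : [0,a] → ℝᵈ`: its total variation on `[0,a]`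
(finite when `γ` is Lipschitz on `[0,a]`). -/
noncomputable def curveLength {d : ℕ} (a : ℝ) (γ : ℝ → EuclideanSpace ℝ (Fin d)) : ℝ :=
  (eVariationOn γ (Icc 0 a)).toReal

/-- `E_μ^{λ,p}(γ) = ∫ d(x, Γ_γ)^p dμ(x) + λ · L(γ)` with `Γ_γ = γ([0,a])`. For `μ` in `𝓜`, `p ≥ 1`
and `γ` in `𝓒` the integrand is continuous, hence bounded on the compact support of `μ` and
integrable. -/
noncomputable def curveEnergy {d : ℕ} (μ : Measure (EuclideanSpace ℝ (Fin d))) (lam p : ℝ)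
    (a : ℝ) (γ : ℝ → EuclideanSpace ℝ (Fin d)) : ℝ :=
  (∫ x, Metric.infDist x (γ '' Icc 0 a) ^ p ∂μ) + lam * curveLength a γ

/-- `γ : [0,a] → ℝᵈ` minimizes `E_μ^{λ,p}` over the whole class `𝓒`, in which the parameter
interval of the competitor is arbitrary too. -/
structure IsEnergyMinimizer {d : ℕ} (μ : Measure (EuclideanSpace ℝ (Fin d))) (lam p : ℝ)
    (a : ℝ) (γ : ℝ → EuclideanSpace ℝ (Fin d)) : Prop where
  admissible : IsAdmissibleCurve a γ
  le : ∀ (b : ℝ) (η : ℝ → EuclideanSpace ℝ (Fin d)), IsAdmissibleCurve b η →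
    curveEnergy μ lam p a γ ≤ curveEnergy μ lam p b η

/-- `μ` is absolutely continuous with respect to Lebesgue measure, with (essentially) bounded
density. -/
def HasBoundedDensity {d : ℕ} (μ : Measure (EuclideanSpace ℝ (Fin d))) : Prop :=
  μ ≪ volume ∧ ∃ M : ℝ≥0, ∀ᵐ x ∂volume, μ.rnDeriv volume x ≤ (M : ℝ≥0∞)

/-! A minimizer `γ` parametrized by arc length is injective. The argument rests on a first variation
inequality (`IsArcLengthMinimizer.first_variation`): if a Lipschitz field `v` along `γ` changes the
length at rate `D`, and if every point outside a set `S` has a foot on the curve that `v` moves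
orthogonally to the point or towards it, then `0 ≤ λ D + p R ^ (p - 1) sup ‖v‖ μ(S)`, where `R`
bounds the distance to the curve on `S`. Only piecewise affine fields are used, for which `D` is an
expression in increments of `γ` (`LengthVariationLE.of_affine`), so no derivative of `γ` enters.

Suppose `γ s = γ t` with `s < t`. A point with a foot at `γ s` may use either parameter, so for
fields supported near `s` the set `S` has small measure. Trapezoidal fields then show that the
difference quotients of `γ` near `s` nearly agree: `γ` has a strict derivative at `s`
(`IsArcLengthMinimizer.exists_hasTangentAt`), which is a unit vector because `γ` has full length. At
an end of the parameter interval the quotients would tend to `0`, so the ends are not double points.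
Traversing the loop between `s` and `t` backwards gives another minimizer, which must not have a
corner either; hence the tangents at `s` and `t` are opposite
(`IsArcLengthMinimizer.tangent_eq_neg`).

Now choose the double point with `t - s` maximal. The two arms `r ↦ γ (s - r)` and `r ↦ γ (t + r)`
leave it in the same direction `e` and, by maximality, do not meet again. In the plane they are
graphs over `e`, one strictly above the other (`IsArm.exists_widest`). Let `W` be their largest
vertical distance on a short window of length `δ`, attained between two points of the arms, and push
the arms apart up to there, with a coefficient that descends with unit slope. The length
changes at a rate close to `-W`. The points outside the arms are approached, and those between the arms
are within `W` of their feet (`IsArm.norm_sub_le_of_foot`), so the force they exert is `O(W)`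
(`exists_force_bound`); this is where `p ≥ 2` or a bounded density is needed. The inequality becomes
`λ W ≤ C δ W`, which is false for small `δ`. -/

/-! ### First variation of length -/

section LengthVariation

lemma LipschitzOnWith.Icc_union {F : Type*} [PseudoMetricSpace F] {f : ℝ → F} {K : ℝ≥0}
    {a b c : ℝ} (hab : LipschitzOnWith K f (Icc a b)) (hbc : LipschitzOnWith K f (Icc b c)) :
    LipschitzOnWith K f (Icc a c) := by
  have key : ∀ x ∈ Icc a c, ∀ y ∈ Icc a c, x ≤ y → dist (f x) (f y) ≤ K * dist x y := by
    intro x hx y hy hxy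
    rcases le_total y b with hyb | hyb
    · exact hab.dist_le_mul x ⟨hx.1, hxy.trans hyb⟩ y ⟨hy.1, hyb⟩
    rcases le_total x b with hxb | hxb
    · have h1 := hab.dist_le_mul x ⟨hx.1, hxb⟩ b ⟨hx.1.trans hxb, le_rfl⟩
      have h2 := hbc.dist_le_mul b ⟨le_rfl, hyb.trans hy.2⟩ y ⟨hyb, hy.2⟩
      have h3 : dist x b + dist b y = dist x y := by
        rw [Real.dist_eq, Real.dist_eq, Real.dist_eq, abs_of_nonpos (by linarith),
          abs_of_nonpos (by linarith), abs_of_nonpos (by linarith)]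
        ring
      calc dist (f x) (f y) ≤ dist (f x) (f b) + dist (f b) (f y) := dist_triangle _ _ _
        _ ≤ K * dist x b + K * dist b y := add_le_add h1 h2
        _ = K * dist x y := by rw [← h3]; ring
    · exact hbc.dist_le_mul x ⟨hxb, hx.2⟩ y ⟨hyb, hy.2⟩
  refine LipschitzOnWith.of_dist_le_mul fun x hx y hy => ?_
  rcases le_total x y with h | h
  · exact key x hx y hy h
  · rw [dist_comm, dist_comm x]
    exact key y hy x hx h

lemma eVariationOn_Icc_add {F : Type*} [PseudoEMetricSpace F] (f : ℝ → F) {a b c : ℝ}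
    (hab : a ≤ b) (hbc : b ≤ c) :
    eVariationOn f (Icc a b) + eVariationOn f (Icc b c) = eVariationOn f (Icc a c) := by
  simpa using eVariationOn.Icc_add_Icc f (s := univ) hab hbc (mem_univ b)

/-- A curve whose increments are dominated by those of a real function `g` has variation at most
the increment of `g`. -/
lemma eVariationOn_le_of_norm_sub_le {F : Type*} [SeminormedAddCommGroup F] {f : ℝ → F}
    {g : ℝ → ℝ} {a b : ℝ} (hab : a ≤ b)
    (h : ∀ x ∈ Icc a b, ∀ y ∈ Icc a b, x ≤ y → ‖f y - f x‖ ≤ g y - g x) :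
    eVariationOn f (Icc a b) ≤ ENNReal.ofReal (g b - g a) := by
  have hmono : MonotoneOn g (Icc a b) := fun x hx y hy hxy =>
    sub_nonneg.1 ((norm_nonneg _).trans (h x hx y hy hxy))
  have hg := hmono.eVariationOn_eq (left_mem_Icc.2 hab) (right_mem_Icc.2 hab)
  rw [inter_self] at hg
  rw [← hg]
  refine iSup_le fun q => ?_
  refine le_trans (Finset.sum_le_sum fun i _ => ?_)
    (eVariationOn.sum_le (f := g) (s := Icc a b) (u := (q.2 : ℕ → ℝ)) q.2.2.1 q.2.2.2)
  rw [edist_dist, edist_dist, dist_eq_norm, Real.dist_eq]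
  exact ENNReal.ofReal_le_ofReal
    ((h _ (q.2.2.2 i) _ (q.2.2.2 (i + 1)) (q.2.2.1 (Nat.le_succ i))).trans (le_abs_self _))

variable {E : Type*} [NormedAddCommGroup E] [InnerProductSpace ℝ E]

/-- `LengthVariationLE γ v a b D` says that `v` is a Lipschitz field along `γ` on `[a, b]` and
that the length of `γ + ε v` on `[a, b]` is at most `(b - a) + ε D + O(ε²)`. For `γ` parametrized
by arc length, `D` is thus an upper bound for the first variation of length in the
direction `v`. -/
structure LengthVariationLE (γ v : ℝ → E) (a b D : ℝ) : Prop where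
  le : a ≤ b
  lipschitz : ∃ K : ℝ≥0, LipschitzOnWith K v (Icc a b)
  bound : ∃ K : ℝ, ∀ ε : ℝ, eVariationOn (fun τ => γ τ + ε • v τ) (Icc a b) ≠ ∞ ∧
    (eVariationOn (fun τ => γ τ + ε • v τ) (Icc a b)).toReal ≤ (b - a) + ε * D + ε ^ 2 * K

namespace LengthVariationLE

variable {γ v w : ℝ → E} {a b c D D' : ℝ}

lemma congr (h : LengthVariationLE γ v a b D) (hvw : EqOn w v (Icc a b)) :
    LengthVariationLE γ w a b D := by
  refine ⟨h.le, ?_, ?_⟩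
  · obtain ⟨K, hK⟩ := h.lipschitz
    exact ⟨K, fun x hx y hy => by rw [hvw hx, hvw hy]; exact hK hx hy⟩
  · obtain ⟨K, hK⟩ := h.bound
    refine ⟨K, fun ε => ?_⟩
    rw [eVariationOn.congr (g := fun τ => γ τ + ε • v τ) fun x hx => by simp [hvw hx]]
    exact hK ε

lemma trans (h : LengthVariationLE γ v a b D) (h' : LengthVariationLE γ v b c D') :
    LengthVariationLE γ v a c (D + D') := by
  refine ⟨h.le.trans h'.le, ?_, ?_⟩
  · obtain ⟨K, hK⟩ := h.lipschitz
    obtain ⟨K', hK'⟩ := h'.lipschitz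
    exact ⟨max K K', (hK.weaken (le_max_left _ _)).Icc_union (hK'.weaken (le_max_right _ _))⟩
  · obtain ⟨K, hK⟩ := h.bound
    obtain ⟨K', hK'⟩ := h'.bound
    refine ⟨K + K', fun ε => ?_⟩
    rw [← eVariationOn_Icc_add _ h.le h'.le, ENNReal.toReal_add (hK ε).1 (hK' ε).1]
    refine ⟨ENNReal.add_ne_top.2 ⟨(hK ε).1, (hK' ε).1⟩, ?_⟩
    linarith [(hK ε).2, (hK' ε).2]

/-- An affine field of slope `c`: the first variation is `⟪γ b - γ a, c⟫`. No derivative of `γ` is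
needed, because `‖z‖ ≤ (‖z‖² / Δ + Δ) / 2` linearizes the length of each increment. -/
lemma of_affine {c : E} (hab : a ≤ b) (hγ : LipschitzOnWith 1 γ (Icc a b))
    (hv : ∀ x ∈ Icc a b, v x = v a + (x - a) • c) :
    LengthVariationLE γ v a b (inner ℝ (γ b - γ a) c) := by
  have hinc : ∀ x ∈ Icc a b, ∀ y ∈ Icc a b, v y - v x = (y - x) • c := by
    intro x hx y hy
    rw [hv x hx, hv y hy, add_sub_add_left_eq_sub, ← sub_smul]
    congr 1
    ring
  refine ⟨hab, ⟨‖c‖₊, LipschitzOnWith.of_dist_le_mul fun x hx y hy => ?_⟩,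
    ⟨‖c‖ ^ 2 * (b - a) / 2, fun ε => ?_⟩⟩
  · rw [dist_eq_norm, hinc y hy x hx, norm_smul, Real.dist_eq, mul_comm]
    rfl
  have key : ∀ x ∈ Icc a b, ∀ y ∈ Icc a b, x ≤ y →
      ‖(γ y + ε • v y) - (γ x + ε • v x)‖ ≤
        (y + ε * inner ℝ (γ y) c + ε ^ 2 * ‖c‖ ^ 2 * y / 2) -
          (x + ε * inner ℝ (γ x) c + ε ^ 2 * ‖c‖ ^ 2 * x / 2) := by
    intro x hx y hy hxy
    have e1 : (γ y + ε • v y) - (γ x + ε • v x) = (γ y - γ x) + (ε * (y - x)) • c := by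
      rw [mul_smul, ← hinc x hx y hy, smul_sub]
      abel
    rw [e1]
    rcases hxy.eq_or_lt with rfl | hlt
    · simp
    have hΔ : 0 < y - x := sub_pos.2 hlt
    have hg : ‖γ y - γ x‖ ≤ y - x := by
      have := hγ.dist_le_mul y hy x hx
      rwa [dist_eq_norm, Real.dist_eq, abs_of_pos hΔ, NNReal.coe_one, one_mul] at this
    have hg2 : ‖γ y - γ x‖ ^ 2 ≤ (y - x) ^ 2 := by gcongr
    have e2 : ‖(γ y - γ x) + (ε * (y - x)) • c‖ ^ 2 =
        ‖γ y - γ x‖ ^ 2 + 2 * (ε * (y - x)) * inner ℝ (γ y - γ x) c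
          + (ε * (y - x)) ^ 2 * ‖c‖ ^ 2 := by
      rw [norm_add_sq_real, inner_smul_right, norm_smul, mul_pow, Real.norm_eq_abs, sq_abs]
      ring
    set z := ‖(γ y - γ x) + (ε * (y - x)) • c‖ with hz
    have e3 : 2 * (y - x) * z ≤ z ^ 2 + (y - x) ^ 2 := by nlinarith [sq_nonneg (z - (y - x))]
    have e4 : inner ℝ (γ y) c - inner ℝ (γ x) c = inner ℝ (γ y - γ x) c :=
      (inner_sub_left _ _ _).symm
    have : (y - x) * z ≤ (y - x) * ((y - x) + ε * inner ℝ (γ y - γ x) c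
        + ε ^ 2 * ‖c‖ ^ 2 * (y - x) / 2) := by nlinarith
    have := le_of_mul_le_mul_left this hΔ
    rw [← e4] at this
    linarith
  have hle := eVariationOn_le_of_norm_sub_le hab key
  have hnn := (norm_nonneg _).trans
    (key a (left_mem_Icc.2 hab) b (right_mem_Icc.2 hab) hab)
  refine ⟨ne_top_of_le_ne_top ENNReal.ofReal_ne_top hle, ?_⟩
  refine (ENNReal.toReal_le_of_le_ofReal hnn hle).trans (le_of_eq ?_)
  rw [inner_sub_left]
  ring

lemma of_zero (hab : a ≤ b) (hγ : LipschitzOnWith 1 γ (Icc a b))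
    (hv : ∀ x ∈ Icc a b, v x = 0) : LengthVariationLE γ v a b 0 := by
  simpa using of_affine (c := (0 : E)) hab hγ (v := v)
    (fun x hx => by simp [hv x hx, hv a (left_mem_Icc.2 hab)])

end LengthVariationLE

/-- The continuous piecewise affine function that vanishes outside `[a, d]`, equals `1` on
`[b, c]`, and is affine on `[a, b]` and on `[c, d]`; the intended range is `a < b ≤ c < d`. -/
noncomputable def trapezoid (a b c d x : ℝ) : ℝ :=
  max 0 (min 1 (min ((x - a) / (b - a)) ((d - x) / (d - c))))

section trapezoid

variable {a b c d x : ℝ}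

lemma trapezoid_nonneg : 0 ≤ trapezoid a b c d x := le_max_left _ _

lemma trapezoid_le_one : trapezoid a b c d x ≤ 1 :=
  max_le zero_le_one (min_le_left _ _)

lemma trapezoid_of_le (hab : a < b) (hx : x ≤ a) : trapezoid a b c d x = 0 := by
  have : (x - a) / (b - a) ≤ 0 := div_nonpos_of_nonpos_of_nonneg (by linarith) (by linarith)
  exact max_eq_left ((min_le_right _ _).trans ((min_le_left _ _).trans this))

lemma trapezoid_of_ge (hcd : c < d) (hx : d ≤ x) : trapezoid a b c d x = 0 := by
  have : (d - x) / (d - c) ≤ 0 := div_nonpos_of_nonpos_of_nonneg (by linarith) (by linarith)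
  exact max_eq_left ((min_le_right _ _).trans ((min_le_right _ _).trans this))

lemma trapezoid_left (hab : a < b) (hbc : b ≤ c) (hcd : c < d) (hx : x ∈ Icc a b) :
    trapezoid a b c d x = (x - a) / (b - a) := by
  have h1 : 0 ≤ (x - a) / (b - a) := div_nonneg (by linarith [hx.1]) (by linarith)
  have h2 : (x - a) / (b - a) ≤ 1 := (div_le_one (by linarith)).2 (by linarith [hx.2])
  have h3 : 1 ≤ (d - x) / (d - c) := (one_le_div (by linarith)).2 (by linarith [hx.2])
  rw [trapezoid, min_eq_left (h2.trans h3), min_eq_right h2, max_eq_right h1]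

lemma trapezoid_middle (hab : a < b) (hcd : c < d) (hx : x ∈ Icc b c) :
    trapezoid a b c d x = 1 := by
  have h1 : 1 ≤ (x - a) / (b - a) := (one_le_div (by linarith)).2 (by linarith [hx.1])
  have h3 : 1 ≤ (d - x) / (d - c) := (one_le_div (by linarith)).2 (by linarith [hx.2])
  rw [trapezoid, min_eq_left (le_min h1 h3), max_eq_right zero_le_one]

lemma trapezoid_right (hab : a < b) (hbc : b ≤ c) (hcd : c < d) (hx : x ∈ Icc c d) :
    trapezoid a b c d x = (d - x) / (d - c) := by
  have h1 : 0 ≤ (d - x) / (d - c) := div_nonneg (by linarith [hx.2]) (by linarith)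
  have h2 : (d - x) / (d - c) ≤ 1 := (div_le_one (by linarith)).2 (by linarith [hx.1])
  have h3 : 1 ≤ (x - a) / (b - a) := (one_le_div (by linarith)).2 (by linarith [hx.1])
  rw [trapezoid, min_eq_right (h2.trans h3), min_eq_right h2, max_eq_right h1]

variable {γ : ℝ → E} {y : ℝ}

/-- First variation of length on `[b, y]` for the trapezoidal field, past its left ramp. -/
lemma lengthVariationLE_trapezoid_right (hab : a < b) (hbc : b ≤ c) (hcd : c < d) (hdy : d ≤ y)
    {z : ℝ} (hz : z ∈ Icc b c) (hγ : LipschitzOnWith 1 γ (Icc z y)) (e : E) :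
    LengthVariationLE γ (fun τ => trapezoid a b c d τ • e) z y
      (-((d - c)⁻¹ * inner ℝ (γ d - γ c) e)) := by
  have h1 : LengthVariationLE γ (fun τ => trapezoid a b c d τ • e) z c 0 := by
    simpa using LengthVariationLE.of_affine (c := (0 : E)) hz.2
      (hγ.mono (Icc_subset_Icc le_rfl (hcd.le.trans hdy)))
      (v := fun τ => trapezoid a b c d τ • e)
      (fun x hx => by
        simp [trapezoid_middle hab hcd ⟨hz.1.trans hx.1, hx.2⟩, trapezoid_middle hab hcd hz])
  have h2 := LengthVariationLE.of_affine (c := (-(d - c)⁻¹) • e) hcd.le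
    (hγ.mono (Icc_subset_Icc hz.2 hdy))
    (v := fun τ => trapezoid a b c d τ • e)
    (fun x hx => by
      have : d - c ≠ 0 := by linarith
      rw [trapezoid_right hab hbc hcd hx, trapezoid_right hab hbc hcd (left_mem_Icc.2 hcd.le),
        smul_smul, ← add_smul]
      congr 1
      field_simp
      ring)
  have h3 := LengthVariationLE.of_zero hdy
    (hγ.mono (Icc_subset_Icc (hz.2.trans hcd.le) le_rfl))
    (v := fun τ => trapezoid a b c d τ • e)
    (fun x hx => by simp [trapezoid_of_ge hcd hx.1])
  have := (h1.trans h2).trans h3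
  simpa [inner_smul_right] using this

/-- First variation of length for a trapezoidal field: the difference of the two difference
quotients of `γ` over the ramps. -/
lemma lengthVariationLE_trapezoid (hxa : x ≤ a) (hab : a < b) (hbc : b ≤ c) (hcd : c < d)
    (hdy : d ≤ y) (hγ : LipschitzOnWith 1 γ (Icc x y)) (e : E) :
    LengthVariationLE γ (fun τ => trapezoid a b c d τ • e) x y
      ((b - a)⁻¹ * inner ℝ (γ b - γ a) e - (d - c)⁻¹ * inner ℝ (γ d - γ c) e) := by
  have h1 := LengthVariationLE.of_zero hxa
    (hγ.mono (Icc_subset_Icc le_rfl (hab.le.trans (hbc.trans (hcd.le.trans hdy)))))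
    (v := fun τ => trapezoid a b c d τ • e)
    (fun x hx => by simp [trapezoid_of_le hab hx.2])
  have h2 := LengthVariationLE.of_affine (c := ((b - a)⁻¹) • e) hab.le
    (hγ.mono (Icc_subset_Icc hxa (hbc.trans (hcd.le.trans hdy))))
    (v := fun τ => trapezoid a b c d τ • e)
    (fun x hx => by
      rw [trapezoid_left hab hbc hcd hx, trapezoid_left hab hbc hcd (left_mem_Icc.2 hab.le),
        smul_smul, ← add_smul]
      congr 1
      ring)
  have h3 := lengthVariationLE_trapezoid_right hab hbc hcd hdy (left_mem_Icc.2 hbc)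
    (hγ.mono (Icc_subset_Icc (hxa.trans hab.le) le_rfl)) e
  have := (h1.trans h2).trans h3
  simpa [inner_smul_right, sub_eq_add_neg] using this

end trapezoid

end LengthVariation

/-! ### First variation of the energy -/

section EnergyVariation

open Filter Topology

lemma rpow_sub_rpow_le {a b p : ℝ} (ha : 0 ≤ a) (hab : a ≤ b) (hp : 1 ≤ p) :
    b ^ p - a ^ p ≤ p * b ^ (p - 1) * (b - a) := by
  rcases (ha.trans hab).eq_or_lt with hb | hb
  · obtain rfl : a = b := le_antisymm hab (hb ▸ ha)
    simp
  have h := one_add_mul_self_le_rpow_one_add (s := a / b - 1)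
    (by linarith [div_nonneg ha hb.le]) hp
  rw [add_sub_cancel, Real.div_rpow ha hb.le, le_div_iff₀ (Real.rpow_pos_of_pos hb p)] at h
  have e : b ^ p = b ^ (p - 1) * b := by
    rw [← Real.rpow_add_one hb.ne', sub_add_cancel]
  have e2 : (1 + p * (a / b - 1)) * b ^ p = b ^ p + p * b ^ (p - 1) * (a - b) := by
    rw [e]
    field_simp
  linarith

/-- The point of the foot condition in the first variation: moving a foot of `x` orthogonally to
`x` or towards `x` costs only `o(ε)`, except where `r = 0` and `p = 1`. -/
lemma tendsto_sqrt_rpow_sub_rpow_div {r p V : ℝ} (hr : 0 ≤ r) (hp : 1 ≤ p)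
    (h : 0 < r ∨ 1 < p) (hV : 0 ≤ V) :
    Tendsto (fun ε => (√(r ^ 2 + (ε * V) ^ 2) ^ p - r ^ p) / ε) (𝓝[>] 0) (𝓝 0) := by
  have hsq : Tendsto (fun ε => √(r ^ 2 + (ε * V) ^ 2)) (𝓝[>] 0) (𝓝 r) := by
    have : Continuous fun ε => √(r ^ 2 + (ε * V) ^ 2) := by fun_prop
    have := this.tendsto 0
    simp only [zero_mul, ne_eq, OfNat.ofNat_ne_zero, not_false_eq_true, zero_pow, add_zero,
      Real.sqrt_sq hr] at this
    exact this.mono_left nhdsWithin_le_nhds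
  have hpow : Tendsto (fun ε => √(r ^ 2 + (ε * V) ^ 2) ^ (p - 1)) (𝓝[>] 0) (𝓝 (r ^ (p - 1))) :=
    hsq.rpow_const (Or.inr (by linarith))
  have hmono : ∀ ε, r ≤ √(r ^ 2 + (ε * V) ^ 2) := fun ε =>
    Real.le_sqrt_of_sq_le (by nlinarith [sq_nonneg (ε * V)])
  have hlow : ∀ᶠ ε in 𝓝[>] (0 : ℝ), 0 ≤ (√(r ^ 2 + (ε * V) ^ 2) ^ p - r ^ p) / ε := by
    filter_upwards [self_mem_nhdsWithin] with ε hε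
    have hε : 0 < ε := hε
    exact div_nonneg (sub_nonneg.2 (Real.rpow_le_rpow hr (hmono ε) (by linarith))) hε.le
  have hid : Tendsto (fun ε : ℝ => ε) (𝓝[>] 0) (𝓝 0) := nhdsWithin_le_nhds
  rcases hr.eq_or_lt with h0 | hpos
  · have hp1 : 1 < p := h.resolve_left (by linarith)
    subst h0
    have hlim : Tendsto (fun ε => p * √(0 ^ 2 + (ε * V) ^ 2) ^ (p - 1) * V) (𝓝[>] 0) (𝓝 0) := by
      have := (hpow.const_mul p).mul_const V
      rwa [Real.zero_rpow (by linarith), mul_zero, zero_mul] at this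
    refine tendsto_of_tendsto_of_tendsto_of_le_of_le' tendsto_const_nhds hlim hlow ?_
    filter_upwards [self_mem_nhdsWithin] with ε hε
    have hε : 0 < ε := hε
    rw [div_le_iff₀ hε]
    refine (rpow_sub_rpow_le le_rfl (hmono ε) hp).trans (le_of_eq ?_)
    have : √(0 ^ 2 + (ε * V) ^ 2) = ε * V := by
      rw [zero_pow two_ne_zero, zero_add, Real.sqrt_sq (by positivity)]
    rw [this]
    ring
  · have hlim : Tendsto (fun ε => p * √(r ^ 2 + (ε * V) ^ 2) ^ (p - 1) * (ε * V ^ 2 / (2 * r)))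
        (𝓝[>] 0) (𝓝 0) := by
      have := (hpow.const_mul p).mul ((hid.mul_const (V ^ 2)).div_const (2 * r))
      rwa [zero_mul, zero_div, mul_zero] at this
    refine tendsto_of_tendsto_of_tendsto_of_le_of_le' tendsto_const_nhds hlim hlow ?_
    filter_upwards [self_mem_nhdsWithin] with ε hε
    have hε : 0 < ε := hε
    rw [div_le_iff₀ hε]
    refine (rpow_sub_rpow_le hr (hmono ε) hp).trans ?_
    have hs : √(r ^ 2 + (ε * V) ^ 2) - r ≤ ε ^ 2 * V ^ 2 / (2 * r) := by
      rw [le_div_iff₀ (by positivity)]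
      have := Real.sq_sqrt (show 0 ≤ r ^ 2 + (ε * V) ^ 2 by positivity)
      nlinarith [sq_nonneg (√(r ^ 2 + (ε * V) ^ 2) - r)]
    calc p * √(r ^ 2 + (ε * V) ^ 2) ^ (p - 1) * (√(r ^ 2 + (ε * V) ^ 2) - r)
        ≤ p * √(r ^ 2 + (ε * V) ^ 2) ^ (p - 1) * (ε ^ 2 * V ^ 2 / (2 * r)) := by gcongr
      _ = _ := by ring

variable {d : ℕ} {μ : Measure (EuclideanSpace ℝ (Fin d))} {lam p L : ℝ}
  {γ : ℝ → EuclideanSpace ℝ (Fin d)}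

lemma IsDataMeasure.exists_bound (hμ : IsDataMeasure μ)
    {f : EuclideanSpace ℝ (Fin d) → ℝ} (hf : Continuous f) :
    ∃ C, 0 ≤ C ∧ ∀ x ∈ μ.support, |f x| ≤ C := by
  obtain ⟨C, hC⟩ := hμ.isCompact_support.exists_bound_of_continuousOn hf.continuousOn
  exact ⟨max C 0, le_max_right _ _, fun x hx => (hC x hx).trans (le_max_left _ _)⟩

lemma IsDataMeasure.integrable_of_continuous (hμ : IsDataMeasure μ)
    {f : EuclideanSpace ℝ (Fin d) → ℝ} (hf : Continuous f) : Integrable f μ := by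
  have := hμ.finite
  obtain ⟨C, -, hC⟩ := hμ.exists_bound hf
  refine Integrable.of_bound hf.aestronglyMeasurable C ?_
  filter_upwards [Measure.support_mem_ae] with x hx using hC x hx

/-- `1`-Lipschitz curves on `[0, L]` whose energy, with the length replaced by its upper bound
`L`, does not exceed the energy of any Lipschitz curve on `[0, L]`. Unlike minimality together
with arc-length parametrization, this is evidently stable under reparametrizations that keep the
image, such as the reversal of a loop. -/
structure IsArcLengthMinimizer (μ : Measure (EuclideanSpace ℝ (Fin d))) (lam p L : ℝ)
    (γ : ℝ → EuclideanSpace ℝ (Fin d)) : Prop where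
  nonneg : 0 ≤ L
  lipschitz : LipschitzOnWith 1 γ (Icc 0 L)
  le : ∀ η : ℝ → EuclideanSpace ℝ (Fin d), (∃ K : ℝ≥0, LipschitzOnWith K η (Icc 0 L)) →
    (∫ x, Metric.infDist x (γ '' Icc 0 L) ^ p ∂μ) + lam * L ≤ curveEnergy μ lam p L η

lemma IsArcLengthMinimizer.of_image_eq (h : IsArcLengthMinimizer μ lam p L γ)
    {η : ℝ → EuclideanSpace ℝ (Fin d)} (hη : LipschitzOnWith 1 η (Icc 0 L))
    (him : η '' Icc 0 L = γ '' Icc 0 L) : IsArcLengthMinimizer μ lam p L η :=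
  ⟨h.nonneg, hη, fun ζ hζ => by rw [him]; exact h.le ζ hζ⟩

lemma IsEnergyMinimizer.isArcLengthMinimizer (h : IsEnergyMinimizer μ lam p L γ)
    (harc : HasUnitSpeedOn γ (Icc 0 L)) : IsArcLengthMinimizer μ lam p L γ := by
  have hL := h.admissible.nonneg
  refine ⟨hL, LipschitzOnWith.of_dist_le_mul ?_, ?_⟩
  · have key : ∀ x ∈ Icc 0 L, ∀ y ∈ Icc 0 L, x ≤ y → dist (γ x) (γ y) ≤ dist x y := by
      intro x hx y hy hxy
      have h1 := eVariationOn.edist_le γ (s := Icc 0 L ∩ Icc x y) (x := x) (y := y)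
        ⟨hx, le_rfl, hxy⟩ ⟨hy, hxy, le_rfl⟩
      rw [harc hx hy, NNReal.coe_one, one_mul, edist_dist] at h1
      have := (ENNReal.ofReal_le_ofReal_iff (by linarith)).1 h1
      rwa [dist_comm x y, Real.dist_eq, abs_of_nonneg (by linarith)]
    intro x hx y hy
    rw [NNReal.coe_one, one_mul]
    rcases le_total x y with hxy | hxy
    · exact key x hx y hy hxy
    · rw [dist_comm, dist_comm x]
      exact key y hy x hx hxy
  · rintro η ⟨K, hK⟩
    -- slow `η` down by the factor `k ≥ 1` to make it admissible
    set k : ℝ≥0 := max K 1 with hk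
    have hk1 : (1 : ℝ) ≤ k := by exact_mod_cast le_max_right K 1
    have hk0 : (0 : ℝ) < k := by linarith
    have hkL : LipschitzOnWith k η (Icc 0 L) := hK.weaken (le_max_left _ _)
    have him : (fun t : ℝ => t / k) '' Icc 0 (k * L) = Icc 0 L := by
      ext x
      constructor
      · rintro ⟨t, ht, rfl⟩
        exact ⟨div_nonneg ht.1 hk0.le, (div_le_iff₀ hk0).2 (by linarith [ht.2])⟩
      · intro hx
        exact ⟨k * x, ⟨mul_nonneg hk0.le hx.1, by gcongr; exact hx.2⟩, by field_simp⟩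
    have hmaps : MapsTo (fun t : ℝ => t / k) (Icc 0 (k * L)) (Icc 0 L) := by
      rw [← him]
      exact mapsTo_image _ _
    have hlip : LipschitzOnWith 1 (η ∘ fun t : ℝ => t / k) (Icc 0 (k * L)) := by
      refine LipschitzOnWith.of_dist_le_mul fun x hx y hy => ?_
      refine (hkL.dist_le_mul _ (hmaps hx) _ (hmaps hy)).trans (le_of_eq ?_)
      rw [Real.dist_eq, Real.dist_eq, ← sub_div, abs_div, abs_of_pos hk0, NNReal.coe_one, one_mul]
      field_simp
    have hle := h.le (k * L) (η ∘ fun t : ℝ => t / k) ⟨by positivity, ⟨1, hlip⟩,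
      ae_of_all _ fun t ht => by
        simpa using norm_deriv_le_of_lipschitzOn (Icc_mem_nhds ht.1 ht.2) hlip⟩
    have hlen : curveLength (k * L) (η ∘ fun t : ℝ => t / k) = curveLength L η := by
      rw [curveLength, curveLength, eVariationOn.comp_eq_of_monotoneOn _ _
        (fun x _ y _ hxy => div_le_div_of_nonneg_right hxy hk0.le), him]
    have hγlen : curveLength L γ = L := by
      have := harc (left_mem_Icc.2 hL) (right_mem_Icc.2 hL)
      rw [inter_self, NNReal.coe_one, one_mul, sub_zero] at this
      rw [curveLength, this, ENNReal.toReal_ofReal hL]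
    rw [curveEnergy, curveEnergy, hlen, image_comp, him, hγlen] at hle
    exact hle

namespace IsArcLengthMinimizer

lemma isCompact_image (h : IsArcLengthMinimizer μ lam p L γ) : IsCompact (γ '' Icc 0 L) :=
  isCompact_Icc.image_of_continuousOn h.lipschitz.continuousOn

lemma exists_foot (h : IsArcLengthMinimizer μ lam p L γ) (x : EuclideanSpace ℝ (Fin d)) :
    ∃ τ ∈ Icc 0 L, dist x (γ τ) = Metric.infDist x (γ '' Icc 0 L) := by
  obtain ⟨_, ⟨τ, hτ, rfl⟩, hx⟩ := h.isCompact_image.exists_infDist_eq_dist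
    ((nonempty_Icc.2 h.nonneg).image γ) x
  exact ⟨τ, hτ, hx.symm⟩

/-- First variation inequality. Each point outside `S` is required to have a foot on the curve
that the field `v` moves orthogonally to the point or towards it, so that only the points of `S`
contribute to the first order. When `p = 1` the image of `γ` has to be negligible, because there
the distance grows at first order. -/
theorem first_variation (h : IsArcLengthMinimizer μ lam p L γ) (hμ : IsDataMeasure μ)
    (hlam : 0 ≤ lam) (hp : 1 ≤ p) (hΓ : p = 1 → μ (γ '' Icc 0 L) = 0)
    {v : ℝ → EuclideanSpace ℝ (Fin d)} {V : ℝ} (hV : ∀ τ ∈ Icc 0 L, ‖v τ‖ ≤ V)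
    {D : ℝ} (hD : LengthVariationLE γ v 0 L D)
    {S : Set (EuclideanSpace ℝ (Fin d))} (hS : MeasurableSet S) {R : ℝ}
    (hR : ∀ x ∈ S, x ∈ μ.support → Metric.infDist x (γ '' Icc 0 L) ≤ R)
    (hfoot : ∀ x ∉ S, ∃ τ ∈ Icc 0 L, dist x (γ τ) = Metric.infDist x (γ '' Icc 0 L) ∧
      0 ≤ inner ℝ (x - γ τ) (v τ)) :
    0 ≤ lam * D + p * R ^ (p - 1) * V * μ.real S := by
  have := hμ.finite
  have hV0 : 0 ≤ V := (norm_nonneg _).trans (hV 0 (left_mem_Icc.2 h.nonneg))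
  set r : EuclideanSpace ℝ (Fin d) → ℝ := fun x => Metric.infDist x (γ '' Icc 0 L) with hr
  have hrc : Continuous r := Metric.continuous_infDist_pt _
  have hr0 : ∀ x, 0 ≤ r x := fun x => Metric.infDist_nonneg
  obtain ⟨C, hC0, hC⟩ := hμ.exists_bound hrc
  obtain ⟨K, hK⟩ := hD.bound
  set G : ℝ → EuclideanSpace ℝ (Fin d) → ℝ :=
    fun ε x => (√(r x ^ 2 + (ε * V) ^ 2) ^ p - r x ^ p) / ε with hG
  have hGc : ∀ ε, Continuous (G ε) := fun ε => by
    have h1 : Continuous fun x => √(r x ^ 2 + (ε * V) ^ 2) := by fun_prop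
    exact ((h1.rpow_const fun _ => Or.inr (by linarith)).sub
      (hrc.rpow_const fun _ => Or.inr (by linarith))).div_const ε
  -- the energy inequality for `γ + ε v`, divided by `ε`
  have main : ∀ ε ∈ Ioc (0 : ℝ) 1, 0 ≤ lam * (D + ε * K) +
      p * (R + ε * V) ^ (p - 1) * V * μ.real S + ∫ x, Sᶜ.indicator (G ε) x ∂μ := by
    intro ε hε
    obtain ⟨hε0, hε1⟩ := hε
    set η : ℝ → EuclideanSpace ℝ (Fin d) := fun τ => γ τ + ε • v τ with hη
    set rη : EuclideanSpace ℝ (Fin d) → ℝ := fun x => Metric.infDist x (η '' Icc 0 L) with hrη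
    have hrηc : Continuous rη := Metric.continuous_infDist_pt _
    have hrη0 : ∀ x, 0 ≤ rη x := fun x => Metric.infDist_nonneg
    have hmem : ∀ τ ∈ Icc 0 L, ∀ x, rη x ≤ ‖(x - γ τ) - ε • v τ‖ := by
      intro τ hτ x
      have := Metric.infDist_le_dist_of_mem (x := x) (mem_image_of_mem η hτ)
      rwa [dist_eq_norm, ← sub_sub] at this
    have hηlip : ∃ K : ℝ≥0, LipschitzOnWith K η (Icc 0 L) := by
      obtain ⟨k, hk⟩ := hD.lipschitz
      refine ⟨1 + k, LipschitzOnWith.of_dist_le_mul fun x hx y hy => ?_⟩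
      have e : η x - η y = (γ x - γ y) + ε • (v x - v y) := by
        simp only [hη, smul_sub]
        abel
      have h1 := h.lipschitz.dist_le_mul x hx y hy
      have h2 := hk.dist_le_mul x hx y hy
      rw [dist_eq_norm] at h1 h2
      rw [dist_eq_norm, e, NNReal.coe_add, add_mul]
      refine (norm_add_le _ _).trans (add_le_add h1 ?_)
      rw [norm_smul, Real.norm_of_nonneg hε0.le]
      exact (mul_le_of_le_one_left (norm_nonneg _) hε1).trans h2
    have hE := h.le η hηlip
    have hlen : curveLength L η ≤ L + ε * D + ε ^ 2 * K := by
      have := (hK ε).2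
      rwa [sub_zero] at this
    have hpt : ∀ x ∈ μ.support, rη x ^ p - r x ^ p ≤
        S.indicator (fun _ => p * (R + ε * V) ^ (p - 1) * (ε * V)) x +
          ε * Sᶜ.indicator (G ε) x := by
      intro x hx
      by_cases hxS : x ∈ S
      · obtain ⟨τ, hτ, hτx⟩ := h.exists_foot x
        have h1 : rη x ≤ r x + ε * V := by
          refine (hmem τ hτ x).trans ((norm_sub_le _ _).trans ?_)
          rw [← dist_eq_norm, hτx, norm_smul, Real.norm_of_nonneg hε0.le]
          gcongr
          exact hV τ hτ
        have h2 := rpow_sub_rpow_le (hr0 x) (by nlinarith : r x ≤ r x + ε * V) hp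
        have h3 : rη x ^ p ≤ (r x + ε * V) ^ p :=
          Real.rpow_le_rpow (hrη0 x) h1 (by linarith)
        have h4 : (r x + ε * V) ^ (p - 1) ≤ (R + ε * V) ^ (p - 1) :=
          Real.rpow_le_rpow (by nlinarith [hr0 x]) (by linarith [hR x hxS hx]) (by linarith)
        have h5 : p * (r x + ε * V) ^ (p - 1) * (ε * V) ≤ p * (R + ε * V) ^ (p - 1) * (ε * V) := by
          gcongr
        simp only [indicator_of_mem hxS, indicator_of_notMem (notMem_compl_iff.2 hxS), mul_zero,
          add_zero]
        rw [add_sub_cancel_left] at h2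
        linarith
      · obtain ⟨τ, hτ, hτx, hin⟩ := hfoot x hxS
        have h1 : rη x ≤ √(r x ^ 2 + (ε * V) ^ 2) := by
          refine (hmem τ hτ x).trans (Real.le_sqrt_of_sq_le ?_)
          rw [norm_sub_sq_real, ← dist_eq_norm, hτx, inner_smul_right, norm_smul,
            Real.norm_of_nonneg hε0.le, mul_pow, mul_pow]
          have h2 : ‖v τ‖ ^ 2 ≤ V ^ 2 := by
            gcongr
            exact hV τ hτ
          nlinarith [mul_nonneg hε0.le hin, mul_le_mul_of_nonneg_left h2 (sq_nonneg ε)]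
        have h3 : rη x ^ p ≤ √(r x ^ 2 + (ε * V) ^ 2) ^ p :=
          Real.rpow_le_rpow (hrη0 x) h1 (by linarith)
        simp only [indicator_of_notMem hxS, indicator_of_mem (mem_compl hxS), zero_add, hG]
        rw [mul_div_cancel₀ _ hε0.ne']
        linarith
    have hint1 : Integrable (fun x => rη x ^ p) μ :=
      hμ.integrable_of_continuous (hrηc.rpow_const fun _ => Or.inr (by linarith))
    have hint2 : Integrable (fun x => r x ^ p) μ :=
      hμ.integrable_of_continuous (hrc.rpow_const fun _ => Or.inr (by linarith))
    have hint3 : Integrable (S.indicator fun _ => p * (R + ε * V) ^ (p - 1) * (ε * V)) μ :=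
      (integrable_const _).indicator hS
    have hint4 : Integrable (fun x => ε * Sᶜ.indicator (G ε) x) μ :=
      ((hμ.integrable_of_continuous (hGc ε)).indicator hS.compl).const_mul ε
    have hint : (∫ x, rη x ^ p ∂μ) - ∫ x, r x ^ p ∂μ ≤
        μ.real S * (p * (R + ε * V) ^ (p - 1) * (ε * V)) +
          ε * ∫ x, Sᶜ.indicator (G ε) x ∂μ := by
      have h1 : ∫ x, (rη x ^ p - r x ^ p) ∂μ ≤
          ∫ x, (S.indicator (fun _ => p * (R + ε * V) ^ (p - 1) * (ε * V)) x +
            ε * Sᶜ.indicator (G ε) x) ∂μ := by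
        refine integral_mono_ae (hint1.sub hint2) (hint3.add hint4) ?_
        filter_upwards [Measure.support_mem_ae] with x hx using hpt x hx
      rwa [integral_sub hint1 hint2, integral_add hint3 hint4, integral_indicator_const _ hS,
        integral_const_mul, smul_eq_mul] at h1
    have hEr : (∫ x, r x ^ p ∂μ) + lam * L ≤ (∫ x, rη x ^ p ∂μ) + lam * curveLength L η := hE
    have hlen' := mul_le_mul_of_nonneg_left hlen hlam
    refine nonneg_of_mul_nonneg_right (a := ε) ?_ hε0
    linarith
  have hlim : Tendsto (fun ε => lam * (D + ε * K) +
      p * (R + ε * V) ^ (p - 1) * V * μ.real S + ∫ x, Sᶜ.indicator (G ε) x ∂μ) (𝓝[>] 0)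
      (𝓝 (lam * (D + 0 * K) + p * (R + 0 * V) ^ (p - 1) * V * μ.real S + ∫ _x, (0 : ℝ) ∂μ)) := by
    have hid : Tendsto (fun ε : ℝ => ε) (𝓝[>] 0) (𝓝 0) := nhdsWithin_le_nhds
    refine Tendsto.add (Tendsto.add (((hid.mul_const K).const_add D).const_mul lam) ?_) ?_
    · exact (((((hid.mul_const V).const_add R).rpow_const (Or.inr (by linarith))).const_mul
        p).mul_const V).mul_const _
    · refine tendsto_integral_filter_of_dominated_convergence
        (fun _ => p * (C + V + V) ^ (p - 1) * V) ?_ ?_ (integrable_const _) ?_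
      · exact Eventually.of_forall fun ε =>
          ((hGc ε).measurable.indicator hS.compl).aestronglyMeasurable
      · filter_upwards [Ioc_mem_nhdsGT (zero_lt_one' ℝ)] with ε hε
        filter_upwards [Measure.support_mem_ae] with x hx
        have hbd : 0 ≤ p * (C + V + V) ^ (p - 1) * V := by positivity
        by_cases hxS : x ∈ S
        · rw [indicator_of_notMem (notMem_compl_iff.2 hxS), norm_zero]
          exact hbd
        rw [indicator_of_mem (mem_compl hxS)]
        have hsq1 : r x ≤ √(r x ^ 2 + (ε * V) ^ 2) :=
          Real.le_sqrt_of_sq_le (by nlinarith [sq_nonneg (ε * V)])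
        have hεV : 0 ≤ ε * V := mul_nonneg hε.1.le hV0
        have hsq2 : √(r x ^ 2 + (ε * V) ^ 2) ≤ r x + ε * V :=
          Real.sqrt_le_iff.2 ⟨add_nonneg (hr0 x) hεV, by nlinarith [hr0 x]⟩
        have hrx : r x ≤ C := (le_abs_self _).trans (hC x hx)
        have hεV' : ε * V ≤ V := mul_le_of_le_one_left hV0 hε.2
        simp only [hG]
        rw [Real.norm_of_nonneg (div_nonneg (sub_nonneg.2
          (Real.rpow_le_rpow (hr0 x) hsq1 (by linarith))) hε.1.le), div_le_iff₀ hε.1]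
        calc _ ≤ p * √(r x ^ 2 + (ε * V) ^ 2) ^ (p - 1) * (√(r x ^ 2 + (ε * V) ^ 2) - r x) :=
              rpow_sub_rpow_le (hr0 x) hsq1 hp
          _ ≤ p * (C + V + V) ^ (p - 1) * (ε * V) := by
              have h1 : √(r x ^ 2 + (ε * V) ^ 2) ^ (p - 1) ≤ (C + V + V) ^ (p - 1) :=
                Real.rpow_le_rpow (Real.sqrt_nonneg _) (by linarith) (by linarith)
              exact mul_le_mul (mul_le_mul_of_nonneg_left h1 (by linarith)) (by linarith)
                (by linarith) (by positivity)
          _ = _ := by ring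
      · have hae : ∀ᵐ x ∂μ, 0 < r x ∨ 1 < p := by
          rcases hp.eq_or_lt with h1 | h1
          · have h0 : ∀ᵐ x ∂μ, x ∉ γ '' Icc 0 L := measure_eq_zero_iff_ae_notMem.1 (hΓ h1.symm)
            filter_upwards [h0] with x hx
            exact Or.inl ((h.isCompact_image.isClosed.notMem_iff_infDist_pos
              ((nonempty_Icc.2 h.nonneg).image γ)).1 hx)
          · exact ae_of_all _ fun x => Or.inr h1
        filter_upwards [hae] with x hx
        by_cases hxS : x ∈ S
        · simp only [indicator_of_notMem (notMem_compl_iff.2 hxS)]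
          exact tendsto_const_nhds
        · simp only [indicator_of_mem (mem_compl hxS)]
          exact tendsto_sqrt_rpow_sub_rpow_div (hr0 x) hp hx hV0
  have := ge_of_tendsto hlim (by
    filter_upwards [Ioc_mem_nhdsGT (zero_lt_one' ℝ)] with ε hε using main ε hε)
  simpa using this

end IsArcLengthMinimizer

end EnergyVariation

/-! ### Tangents at double points -/

section DoublePoints

open Filter Topology

variable {d : ℕ} {μ : Measure (EuclideanSpace ℝ (Fin d))} {lam p L : ℝ}
  {γ : ℝ → EuclideanSpace ℝ (Fin d)}

/-- `γ` is strictly differentiable at `s` with derivative `T`, in explicit form: all increments of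
`γ` near `s` are uniformly close to those of the line with velocity `T`. -/
def HasTangentAt (γ : ℝ → EuclideanSpace ℝ (Fin d)) (s : ℝ) (T : EuclideanSpace ℝ (Fin d)) :
    Prop :=
  ∀ ε > 0, ∃ δ > 0, ∀ a b, s - δ ≤ a → a ≤ b → b ≤ s + δ →
    ‖γ b - γ a - (b - a) • T‖ ≤ ε * (b - a)

/-- The points with a foot in the parameter window `[s - δ, s + δ]`, but not at `s` itself. -/
def feetNear (γ : ℝ → EuclideanSpace ℝ (Fin d)) (L s δ : ℝ) : Set (EuclideanSpace ℝ (Fin d)) :=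
  {x | Metric.infDist x (γ '' (Icc 0 L ∩ Icc (s - δ) (s + δ))) ≤ Metric.infDist x (γ '' Icc 0 L)} \
    {x | dist x (γ s) ≤ Metric.infDist x (γ '' Icc 0 L)}

lemma measurableSet_feetNear (γ : ℝ → EuclideanSpace ℝ (Fin d)) (L s δ : ℝ) :
    MeasurableSet (feetNear γ L s δ) :=
  (isClosed_le (Metric.continuous_infDist_pt _) (Metric.continuous_infDist_pt _)).measurableSet.diff
    (isClosed_le (by fun_prop) (Metric.continuous_infDist_pt _)).measurableSet

namespace IsArcLengthMinimizer

lemma exists_measure_feetNear_lt (h : IsArcLengthMinimizer μ lam p L γ) (hμ : IsDataMeasure μ)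
    {s : ℝ} (hs : s ∈ Icc 0 L) {κ : ℝ} (hκ : 0 < κ) {δ₀ : ℝ} (hδ₀ : 0 < δ₀) :
    ∃ δ > 0, δ < δ₀ ∧ μ.real (feetNear γ L s δ) < κ := by
  have := hμ.finite
  set u : ℕ → ℝ := fun n => 1 / ((n : ℝ) + 1) with hu
  have hu0 : ∀ n, 0 < u n := fun n => Nat.one_div_pos_of_nat
  have hulim : Tendsto u atTop (𝓝 0) := tendsto_one_div_add_atTop_nhds_zero_nat
  have huanti : Antitone u := fun m n hmn => Nat.one_div_le_one_div hmn
  have hanti : Antitone fun n => feetNear γ L s (u n) := by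
    intro m n hmn x hx
    refine ⟨(?_ : Metric.infDist x _ ≤ Metric.infDist x _).trans hx.1, hx.2⟩
    refine Metric.infDist_le_infDist_of_subset (image_mono ?_)
      (Set.Nonempty.image γ ⟨s, hs, by linarith [hu0 n], by linarith [hu0 n]⟩)
    have := huanti hmn
    exact inter_subset_inter_right _ (Icc_subset_Icc (by linarith) (by linarith))
  have hempty : ⋂ n, feetNear γ L s (u n) = ∅ := by
    rw [eq_empty_iff_forall_notMem]
    intro x hx
    rw [mem_iInter] at hx
    have hfeet : ∀ n, ∃ τ ∈ Icc 0 L ∩ Icc (s - u n) (s + u n),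
        dist x (γ τ) ≤ Metric.infDist x (γ '' Icc 0 L) := by
      intro n
      have hcomp : IsCompact (γ '' (Icc 0 L ∩ Icc (s - u n) (s + u n))) :=
        (isCompact_Icc.inter_right isClosed_Icc).image_of_continuousOn
          (h.lipschitz.continuousOn.mono inter_subset_left)
      obtain ⟨_, ⟨τ, hτ, rfl⟩, hd⟩ := hcomp.exists_infDist_eq_dist
        (Set.Nonempty.image γ ⟨s, hs, by linarith [hu0 n], by linarith [hu0 n]⟩) x
      exact ⟨τ, hτ, hd ▸ (hx n).1⟩
    choose τ hτ hτd using hfeet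
    have hlim : Tendsto τ atTop (𝓝[Icc 0 L] s) := by
      refine tendsto_nhdsWithin_iff.2 ⟨?_, Eventually.of_forall fun n => (hτ n).1⟩
      refine tendsto_of_tendsto_of_tendsto_of_le_of_le (g := fun n => s - u n)
        (h := fun n => s + u n) ?_ ?_ (fun n => (hτ n).2.1) (fun n => (hτ n).2.2)
      · simpa using hulim.const_sub s
      · simpa using hulim.const_add s
    have hγs : Tendsto (fun n => dist x (γ (τ n))) atTop (𝓝 (dist x (γ s))) :=
      tendsto_const_nhds.dist ((h.lipschitz.continuousOn s hs).tendsto.comp hlim)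
    exact (hx 0).2 (le_of_tendsto hγs (Eventually.of_forall hτd))
  have hlim := tendsto_measure_iInter_atTop (μ := μ)
    (fun n => (measurableSet_feetNear γ L s (u n)).nullMeasurableSet) hanti
    ⟨0, measure_ne_top _ _⟩
  rw [hempty, measure_empty] at hlim
  have h1 := (hlim.eventually_lt_const (ENNReal.ofReal_pos.2 hκ)).and
    (hulim.eventually_lt_const hδ₀)
  obtain ⟨n, hn, hn'⟩ := h1.exists
  exact ⟨u n, hu0 n, hn', (ENNReal.lt_ofReal_iff_toReal_lt (measure_ne_top _ _)).1 hn⟩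

/-- At a double point `γ s = γ t` the length variation of fields supported near `s` is almost
nonnegative: a point with a foot at `s` may use the foot at `t`, which does not move, and few
points have their feet elsewhere near `s`. -/
lemma exists_localized_variation (h : IsArcLengthMinimizer μ lam p L γ) (hμ : IsDataMeasure μ)
    (hlam : 0 < lam) (hp : 1 ≤ p) (hΓ : p = 1 → μ (γ '' Icc 0 L) = 0) {s t : ℝ}
    (hs : s ∈ Icc 0 L) (ht : t ∈ Icc 0 L) (hst : s ≠ t) (heq : γ s = γ t)
    {κ : ℝ} (hκ : 0 < κ) {δ₀ : ℝ} (hδ₀ : 0 < δ₀) :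
    ∃ δ > 0, δ < δ₀ ∧ ∀ (φ : ℝ → ℝ) (e : EuclideanSpace ℝ (Fin d)) (D : ℝ),
      (∀ τ, |φ τ| ≤ 1) → (∀ τ ∈ Icc 0 L, τ ∉ Icc (s - δ) (s + δ) → φ τ = 0) →
      LengthVariationLE γ (fun τ => φ τ • e) 0 L D → -(κ * ‖e‖) ≤ D := by
  obtain ⟨C, hC0, hC⟩ := hμ.exists_bound (Metric.continuous_infDist_pt (γ '' Icc 0 L))
  have hB : 0 ≤ p * C ^ (p - 1) := by positivity
  obtain ⟨δ, hδ0, hδ, hδμ⟩ := h.exists_measure_feetNear_lt hμ hs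
    (κ := lam * κ / (p * C ^ (p - 1) + 1)) (by positivity)
    (lt_min hδ₀ (abs_pos.2 (sub_ne_zero.2 hst)))
  refine ⟨δ, hδ0, hδ.trans_le (min_le_left _ _), fun φ e D hφ1 hφ0 hD => ?_⟩
  have htδ : t ∉ Icc (s - δ) (s + δ) := by
    intro ht'
    have h1 : δ < |s - t| := hδ.trans_le (min_le_right _ _)
    have h2 : |s - t| ≤ δ := abs_le.2 ⟨by linarith [ht'.2], by linarith [ht'.1]⟩
    linarith
  have hfv := h.first_variation hμ hlam.le hp hΓ (V := ‖e‖) (fun τ _ => by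
      rw [norm_smul]
      exact mul_le_of_le_one_left (norm_nonneg _) (hφ1 τ)) hD
    (measurableSet_feetNear γ L s δ) (fun x _ hx => (le_abs_self _).trans (hC x hx))
    (fun x hx => by
      obtain ⟨τ, hτ, hτx⟩ := h.exists_foot x
      by_cases hτδ : τ ∈ Icc (s - δ) (s + δ)
      · have hxs : dist x (γ s) ≤ Metric.infDist x (γ '' Icc 0 L) := by
          by_contra hcon
          refine hx ⟨?_, hcon⟩
          rw [mem_ofPred_eq, ← hτx]
          exact Metric.infDist_le_dist_of_mem (mem_image_of_mem γ ⟨hτ, hτδ⟩)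
        refine ⟨t, ht, le_antisymm (heq ▸ hxs)
          (Metric.infDist_le_dist_of_mem (mem_image_of_mem γ ht)), ?_⟩
        simp [hφ0 t ht htδ]
      · exact ⟨τ, hτ, hτx, by simp [hφ0 τ hτ hτδ]⟩)
  have h1 : p * C ^ (p - 1) * μ.real (feetNear γ L s δ) ≤ lam * κ := by
    rw [lt_div_iff₀ (by positivity)] at hδμ
    nlinarith [measureReal_nonneg (μ := μ) (s := feetNear γ L s δ)]
  have h2 : 0 ≤ lam * (D + κ * ‖e‖) := by
    nlinarith [mul_le_mul_of_nonneg_right h1 (norm_nonneg e)]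
  linarith [nonneg_of_mul_nonneg_right h2 hlam]

/-- A minimizer has full length, so it does not move slower than `1` on any interval. -/
lemma one_le_of_norm_sub_le (h : IsArcLengthMinimizer μ lam p L γ) (hlam : 0 < lam)
    {a b κ : ℝ} (ha : 0 ≤ a) (hab : a < b) (hb : b ≤ L)
    (hκ : ∀ x ∈ Icc a b, ∀ y ∈ Icc a b, x ≤ y → ‖γ y - γ x‖ ≤ κ * (y - x)) : 1 ≤ κ := by
  have hκ0 : 0 ≤ κ * (b - a) := (norm_nonneg _).trans
    (hκ a (left_mem_Icc.2 hab.le) b (right_mem_Icc.2 hab.le) hab.le)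
  have hmin := h.le γ ⟨1, h.lipschitz⟩
  have hL : L ≤ curveLength L γ := by
    rw [curveEnergy] at hmin
    exact le_of_mul_le_mul_left (by linarith) hlam
  have hone : ∀ x y, 0 ≤ x → x ≤ y → y ≤ L → eVariationOn γ (Icc x y) ≤ ENNReal.ofReal (y - x) := by
    intro x y hx hxy hy
    refine eVariationOn_le_of_norm_sub_le (g := fun τ => τ) hxy fun u hu v hv huv => ?_
    have := h.lipschitz.dist_le_mul v ⟨hx.trans hv.1, hv.2.trans hy⟩ u
      ⟨hx.trans hu.1, hu.2.trans hy⟩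
    rwa [dist_eq_norm, Real.dist_eq, abs_of_nonneg (by linarith), NNReal.coe_one, one_mul] at this
  have hmid : eVariationOn γ (Icc a b) ≤ ENNReal.ofReal (κ * b - κ * a) :=
    eVariationOn_le_of_norm_sub_le (g := fun τ => κ * τ) hab.le fun u hu v hv huv => by
      rw [← mul_sub]
      exact hκ u hu v hv huv
  have htot : eVariationOn γ (Icc 0 L) ≤ ENNReal.ofReal (a + (κ * b - κ * a) + (L - b)) := by
    rw [← eVariationOn_Icc_add γ (ha.trans hab.le) hb, ← eVariationOn_Icc_add γ ha hab.le,
      ENNReal.ofReal_add (by linarith) (by linarith), ENNReal.ofReal_add ha (by linarith)]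
    exact add_le_add (add_le_add (by simpa using hone 0 a le_rfl ha (hab.le.trans hb)) hmid)
      (hone b L (ha.trans hab.le) hb le_rfl)
  have := ENNReal.toReal_le_of_le_ofReal (by linarith) htot
  rw [curveLength] at hL
  have h3 : 1 * (b - a) ≤ κ * (b - a) := by linarith
  exact le_of_mul_le_mul_right h3 (by linarith)

/-- The initial point is not a double point: otherwise the curve would gain by being shortened
there. -/
lemma apply_zero_ne (h : IsArcLengthMinimizer μ lam p L γ) (hμ : IsDataMeasure μ)
    (hlam : 0 < lam) (hp : 1 ≤ p) (hΓ : p = 1 → μ (γ '' Icc 0 L) = 0) {t : ℝ}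
    (ht : t ∈ Ioc 0 L) : γ 0 ≠ γ t := by
  intro heq
  have hL : 0 < L := ht.1.trans_le ht.2
  obtain ⟨δ, hδ0, hδL, hδ⟩ := h.exists_localized_variation hμ hlam hp hΓ
    (left_mem_Icc.2 hL.le) (Ioc_subset_Icc_self ht) ht.1.ne heq (κ := 1 / 2) (by norm_num) hL
  have key : ∀ x ∈ Icc 0 δ, ∀ y ∈ Icc 0 δ, x ≤ y → ‖γ y - γ x‖ ≤ 1 / 2 * (y - x) := by
    intro x hx y hy hxy
    rcases hxy.eq_or_lt with rfl | hlt
    · simp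
    -- the left ramp `[-2, -1]` lies outside the domain
    have hlen := lengthVariationLE_trapezoid_right (a := -2) (b := -1) (by norm_num)
      (by linarith [hx.1]) hlt (hy.2.trans hδL.le) (z := 0) ⟨by norm_num, hx.1⟩
      h.lipschitz (γ y - γ x)
    have := hδ _ _ _ (fun τ => by
        rw [abs_of_nonneg trapezoid_nonneg]
        exact trapezoid_le_one) (fun τ hτ hτδ => trapezoid_of_ge hlt (by
        by_contra hcon
        exact hτδ ⟨by linarith [hτ.1], by linarith [hy.2]⟩)) hlen
    rw [real_inner_self_eq_norm_sq] at this
    have hyx : 0 < y - x := sub_pos.2 hlt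
    rcases (norm_nonneg (γ y - γ x)).eq_or_lt with h0 | h0
    · rw [← h0]
      positivity
    have h1 : ‖γ y - γ x‖ ^ 2 ≤ 1 / 2 * ‖γ y - γ x‖ * (y - x) := by
      rw [neg_le_neg_iff, inv_mul_eq_div, div_le_iff₀ hyx] at this
      exact this
    nlinarith
  have := h.one_le_of_norm_sub_le hlam le_rfl hδ0 hδL.le key
  norm_num at this

lemma comp_reflect (h : IsArcLengthMinimizer μ lam p L γ) :
    IsArcLengthMinimizer μ lam p L (fun τ => γ (L - τ)) := by
  refine h.of_image_eq (LipschitzOnWith.of_dist_le_mul fun x hx y hy => ?_) ?_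
  · have := h.lipschitz.dist_le_mul (L - x) ⟨by linarith [hx.2], by linarith [hx.1]⟩
      (L - y) ⟨by linarith [hy.2], by linarith [hy.1]⟩
    rwa [dist_sub_left] at this
  · rw [show (fun τ => γ (L - τ)) = γ ∘ (fun τ => L - τ) from rfl, image_comp,
      image_const_sub_Icc, sub_self, sub_zero]

lemma apply_right_ne (h : IsArcLengthMinimizer μ lam p L γ) (hμ : IsDataMeasure μ)
    (hlam : 0 < lam) (hp : 1 ≤ p) (hΓ : p = 1 → μ (γ '' Icc 0 L) = 0) {t : ℝ}
    (ht : t ∈ Ico 0 L) : γ L ≠ γ t := by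
  have him : (fun τ => γ (L - τ)) '' Icc 0 L = γ '' Icc 0 L := by
    rw [show (fun τ => γ (L - τ)) = γ ∘ (fun τ => L - τ) from rfl, image_comp,
      image_const_sub_Icc, sub_self, sub_zero]
  simpa using h.comp_reflect.apply_zero_ne hμ hlam hp (by rwa [him]) (t := L - t)
    ⟨by linarith [ht.2], by linarith [ht.1]⟩

/-- Trapezoidal fields with ramps on two disjoint intervals near a double point compare the slopes
of `γ` over these intervals. -/
lemma exists_norm_slope_sub_le (h : IsArcLengthMinimizer μ lam p L γ) (hμ : IsDataMeasure μ)
    (hlam : 0 < lam) (hp : 1 ≤ p) (hΓ : p = 1 → μ (γ '' Icc 0 L) = 0) {s t : ℝ}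
    (hs : s ∈ Ioo 0 L) (ht : t ∈ Icc 0 L) (hst : s ≠ t) (heq : γ s = γ t)
    {κ : ℝ} (hκ : 0 < κ) :
    ∃ δ > 0, ∀ a b x y, s - δ ≤ a → a < b → b ≤ x → x < y → y ≤ s + δ →
      ‖(b - a)⁻¹ • (γ b - γ a) - (y - x)⁻¹ • (γ y - γ x)‖ ≤ κ := by
  obtain ⟨δ, hδ0, hδs, hδ⟩ := h.exists_localized_variation hμ hlam hp hΓ
    (Ioo_subset_Icc_self hs) ht hst heq hκ (lt_min hs.1 (sub_pos.2 hs.2))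
  have hδ1 : δ < s := hδs.trans_le (min_le_left _ _)
  have hδ2 : δ < L - s := hδs.trans_le (min_le_right _ _)
  refine ⟨δ, hδ0, fun a b x y ha hab hbx hxy hy => ?_⟩
  set X := (b - a)⁻¹ • (γ b - γ a) - (y - x)⁻¹ • (γ y - γ x) with hX
  have hlen := lengthVariationLE_trapezoid (x := 0) (by linarith) hab hbx hxy
    (show y ≤ L by linarith) h.lipschitz (-X)
  have := hδ _ _ _ (fun τ => by
      rw [abs_of_nonneg trapezoid_nonneg]
      exact trapezoid_le_one) (fun τ hτ hτδ => by
      rcases le_total τ a with hτa | hτa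
      · exact trapezoid_of_le hab hτa
      · refine trapezoid_of_ge hxy ?_
        by_contra hcon
        exact hτδ ⟨by linarith, by linarith⟩) hlen
  rw [← real_inner_smul_left, ← real_inner_smul_left, ← inner_sub_left, ← hX, inner_neg_right,
    real_inner_self_eq_norm_sq, norm_neg, neg_le_neg_iff] at this
  rcases (norm_nonneg X).eq_or_lt with h0 | h0
  · rw [← h0]
    exact hκ.le
  · nlinarith

lemma exists_hasTangentAt (h : IsArcLengthMinimizer μ lam p L γ) (hμ : IsDataMeasure μ)
    (hlam : 0 < lam) (hp : 1 ≤ p) (hΓ : p = 1 → μ (γ '' Icc 0 L) = 0) {s t : ℝ}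
    (hs : s ∈ Ioo 0 L) (ht : t ∈ Icc 0 L) (hst : s ≠ t) (heq : γ s = γ t) :
    ∃ T, HasTangentAt γ s T := by
  set q : ℝ → EuclideanSpace ℝ (Fin d) := fun r => (s + r - s)⁻¹ • (γ (s + r) - γ s) with hq
  -- all slopes near `s` are compared with the slope over the interval `[s + δ / 2, s + δ]`
  have key : ∀ κ > 0, ∃ δ > 0, ∃ Q, ∀ a b, s - δ ≤ a → a < b → b ≤ s + δ →
      ‖(b - a)⁻¹ • (γ b - γ a) - Q‖ ≤ κ := by
    intro κ hκ
    obtain ⟨δ, hδ0, hδ⟩ := h.exists_norm_slope_sub_le hμ hlam hp hΓ hs ht hst heq hκ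
    exact ⟨δ / 2, by linarith, (s + δ - (s + δ / 2))⁻¹ • (γ (s + δ) - γ (s + δ / 2)),
      fun a b ha hab hb => hδ a b _ _ (by linarith) hab hb (by linarith) le_rfl⟩
  have hcauchy : Cauchy (map q (𝓝[>] 0)) := by
    refine Metric.cauchy_iff.2 ⟨inferInstance, fun ε hε => ?_⟩
    obtain ⟨δ, hδ0, Q, hQ⟩ := key (ε / 3) (by linarith)
    refine ⟨q '' Ioc 0 δ, image_mem_map (Ioc_mem_nhdsGT hδ0), ?_⟩
    rintro _ ⟨x, hx, rfl⟩ _ ⟨y, hy, rfl⟩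
    have h1 := hQ s (s + x) (by linarith) (by linarith [hx.1]) (by linarith [hx.2])
    have h2 := hQ s (s + y) (by linarith) (by linarith [hy.1]) (by linarith [hy.2])
    rw [← dist_eq_norm] at h1 h2
    rw [dist_comm] at h2
    have := dist_triangle (q x) Q (q y)
    simp only [hq] at this ⊢
    linarith
  obtain ⟨T, hT⟩ := CompleteSpace.complete hcauchy
  have hT : Tendsto q (𝓝[>] 0) (𝓝 T) := hT
  refine ⟨T, fun ε hε => ?_⟩
  obtain ⟨δ, hδ0, Q, hQ⟩ := key (ε / 2) (by linarith)
  have hTQ : ‖T - Q‖ ≤ ε / 2 := by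
    refine le_of_tendsto (hT.sub_const Q).norm ?_
    filter_upwards [Ioc_mem_nhdsGT hδ0] with x hx
    exact hQ s (s + x) (by linarith) (by linarith [hx.1]) (by linarith [hx.2])
  refine ⟨δ, hδ0, fun a b ha hab hb => ?_⟩
  rcases hab.eq_or_lt with rfl | hlt
  · simp
  have hba : 0 < b - a := sub_pos.2 hlt
  have h1 : ‖(b - a)⁻¹ • (γ b - γ a) - T‖ ≤ ε := by
    have := norm_sub_le_norm_sub_add_norm_sub ((b - a)⁻¹ • (γ b - γ a)) Q T
    rw [norm_sub_rev Q T] at this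
    linarith [hQ a b ha hlt hb]
  have h2 : γ b - γ a - (b - a) • T = (b - a) • ((b - a)⁻¹ • (γ b - γ a) - T) := by
    rw [smul_sub, smul_inv_smul₀ hba.ne']
  rw [h2, norm_smul, Real.norm_of_nonneg hba.le, mul_comm]
  gcongr

lemma norm_tangent (h : IsArcLengthMinimizer μ lam p L γ) (hlam : 0 < lam) {s : ℝ}
    (hs : s ∈ Ioo 0 L) {T : EuclideanSpace ℝ (Fin d)} (hT : HasTangentAt γ s T) : ‖T‖ = 1 := by
  refine le_antisymm (le_of_forall_pos_le_add fun ε hε => ?_)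
    (le_of_forall_pos_le_add fun ε hε => ?_)
  all_goals
    obtain ⟨δ₀, hδ₀, hδT⟩ := hT ε hε
    obtain ⟨δ, hδ, hδmin⟩ := exists_between (lt_min hδ₀ (sub_pos.2 hs.2))
    have hδ1 : δ < δ₀ := hδmin.trans_le (min_le_left _ _)
    have hδ2 : δ < L - s := hδmin.trans_le (min_le_right _ _)
  · have h1 := hδT s (s + δ) (by linarith) (by linarith) (by linarith)
    have h2 := h.lipschitz.dist_le_mul (s + δ) ⟨by linarith [hs.1], by linarith⟩ s
      ⟨hs.1.le, hs.2.le⟩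
    rw [dist_eq_norm, Real.dist_eq, add_sub_cancel_left, abs_of_pos hδ, NNReal.coe_one,
      one_mul] at h2
    rw [add_sub_cancel_left] at h1
    have h3 : ‖δ • T‖ ≤ ‖γ (s + δ) - γ s‖ + ‖γ (s + δ) - γ s - δ • T‖ := by
      rw [norm_sub_rev (γ (s + δ) - γ s) (δ • T)]
      exact norm_le_norm_add_norm_sub' _ _
    rw [norm_smul, Real.norm_of_nonneg hδ.le] at h3
    nlinarith
  · refine h.one_le_of_norm_sub_le hlam hs.1.le (b := s + δ) (by linarith) (by linarith)
      fun x hx y hy hxy => ?_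
    have h1 := hδT x y (by linarith [hx.1]) hxy (by linarith [hy.2])
    have h2 : ‖γ y - γ x‖ ≤ ‖(y - x) • T‖ + ‖γ y - γ x - (y - x) • T‖ :=
      norm_le_norm_add_norm_sub' _ _
    rw [norm_smul, Real.norm_of_nonneg (by linarith)] at h2
    nlinarith

end IsArcLengthMinimizer

/-- The curve that traverses the loop of `γ` between the parameters `s` and `t` backwards. -/
noncomputable def reverseLoop (γ : ℝ → EuclideanSpace ℝ (Fin d)) (s t τ : ℝ) :
    EuclideanSpace ℝ (Fin d) :=
  if s ≤ τ ∧ τ ≤ t then γ (s + t - τ) else γ τ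

lemma reverseLoop_of_mem {s t τ : ℝ} (h : τ ∈ Icc s t) :
    reverseLoop γ s t τ = γ (s + t - τ) := if_pos h

lemma reverseLoop_of_le {s t τ : ℝ} (heq : γ s = γ t) (h : τ ≤ s) :
    reverseLoop γ s t τ = γ τ := by
  unfold reverseLoop
  split_ifs with hτ
  · obtain rfl : τ = s := le_antisymm h hτ.1
    rw [add_sub_cancel_left, heq]
  · rfl

lemma reverseLoop_of_ge {s t τ : ℝ} (heq : γ s = γ t) (h : t ≤ τ) :
    reverseLoop γ s t τ = γ τ := by
  unfold reverseLoop
  split_ifs with hτ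
  · obtain rfl : τ = t := le_antisymm hτ.2 h
    rw [add_sub_cancel_right, heq]
  · rfl

lemma reverseLoop_image {s t : ℝ} (h0 : 0 ≤ s) (htL : t ≤ L) :
    reverseLoop γ s t '' Icc 0 L = γ '' Icc 0 L := by
  apply Subset.antisymm
  · rintro _ ⟨τ, hτ, rfl⟩
    unfold reverseLoop
    split_ifs with hτ'
    · exact mem_image_of_mem γ ⟨by linarith [hτ'.2], by linarith [hτ'.1]⟩
    · exact mem_image_of_mem γ hτ
  · rintro _ ⟨τ, hτ, rfl⟩
    by_cases hτ' : s ≤ τ ∧ τ ≤ t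
    · refine ⟨s + t - τ, ⟨by linarith [hτ'.2], by linarith [hτ'.1]⟩, ?_⟩
      rw [reverseLoop_of_mem ⟨by linarith [hτ'.2], by linarith [hτ'.1]⟩, sub_sub_cancel]
    · exact ⟨τ, hτ, if_neg hτ'⟩

namespace IsArcLengthMinimizer

lemma reverseLoop (h : IsArcLengthMinimizer μ lam p L γ) {s t : ℝ} (h0 : 0 ≤ s) (hst : s ≤ t)
    (htL : t ≤ L) (heq : γ s = γ t) : IsArcLengthMinimizer μ lam p L (reverseLoop γ s t) := by
  refine h.of_image_eq ?_ (reverseLoop_image h0 htL)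
  have h1 : LipschitzOnWith 1 (_root_.reverseLoop γ s t) (Icc 0 s) := fun x hx y hy => by
    rw [reverseLoop_of_le heq hx.2, reverseLoop_of_le heq hy.2]
    exact h.lipschitz ⟨hx.1, by linarith [hx.2]⟩ ⟨hy.1, by linarith [hy.2]⟩
  have h2 : LipschitzOnWith 1 (_root_.reverseLoop γ s t) (Icc s t) :=
    LipschitzOnWith.of_dist_le_mul fun x hx y hy => by
      rw [reverseLoop_of_mem hx, reverseLoop_of_mem hy, ← dist_sub_left (s + t) x y]
      exact h.lipschitz.dist_le_mul _ ⟨by linarith [hx.2], by linarith [hx.1]⟩ _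
        ⟨by linarith [hy.2], by linarith [hy.1]⟩
  have h3 : LipschitzOnWith 1 (_root_.reverseLoop γ s t) (Icc t L) := fun x hx y hy => by
    rw [reverseLoop_of_ge heq hx.1, reverseLoop_of_ge heq hy.1]
    exact h.lipschitz ⟨by linarith [hx.1], hx.2⟩ ⟨by linarith [hy.1], hy.2⟩
  exact (h1.Icc_union h2).Icc_union h3

/-- At a double point the two tangents are opposite. Otherwise reversing the loop between the two
parameters would yield a minimizer with a corner. -/
lemma tangent_eq_neg (h : IsArcLengthMinimizer μ lam p L γ) (hμ : IsDataMeasure μ)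
    (hlam : 0 < lam) (hp : 1 ≤ p) (hΓ : p = 1 → μ (γ '' Icc 0 L) = 0) {s t : ℝ}
    (hs : 0 < s) (hst : s < t) (ht : t < L) (heq : γ s = γ t)
    {T T' : EuclideanSpace ℝ (Fin d)} (hT : HasTangentAt γ s T) (hT' : HasTangentAt γ t T') :
    T' = -T := by
  have hr := h.reverseLoop hs.le hst.le ht.le heq
  have hrs : _root_.reverseLoop γ s t s = γ t := by
    rw [reverseLoop_of_le heq le_rfl, heq]
  have hrt : _root_.reverseLoop γ s t t = γ t := reverseLoop_of_ge heq le_rfl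
  obtain ⟨U, hU⟩ := hr.exists_hasTangentAt hμ hlam hp
    (by rwa [reverseLoop_image hs.le ht.le]) (s := s) (t := t)
    ⟨hs, hst.trans ht⟩ ⟨hs.le.trans hst.le, ht.le⟩ hst.ne (hrs.trans hrt.symm)
  have hsmall : ∀ ε > 0, ‖T - U‖ ≤ 2 * ε ∧ ‖T' + U‖ ≤ 2 * ε := by
    intro ε hε
    obtain ⟨δ₁, hδ₁, h1⟩ := hT ε hε
    obtain ⟨δ₂, hδ₂, h2⟩ := hT' ε hε
    obtain ⟨δ₃, hδ₃, h3⟩ := hU ε hε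
    set δ := min (min δ₁ δ₂) (min δ₃ (t - s)) with hδ
    have hδ0 : 0 < δ := lt_min (lt_min hδ₁ hδ₂) (lt_min hδ₃ (sub_pos.2 hst))
    have l1 : δ ≤ δ₁ := (min_le_left _ _).trans (min_le_left _ _)
    have l2 : δ ≤ δ₂ := (min_le_left _ _).trans (min_le_right _ _)
    have l3 : δ ≤ δ₃ := (min_le_right _ _).trans (min_le_left _ _)
    have l4 : δ ≤ t - s := (min_le_right _ _).trans (min_le_right _ _)
    have cancel : ∀ X : EuclideanSpace ℝ (Fin d), ‖δ • X‖ ≤ ε * δ + ε * δ → ‖X‖ ≤ 2 * ε := by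
      intro X hX
      rw [norm_smul, Real.norm_of_nonneg hδ0.le] at hX
      exact le_of_mul_le_mul_left (by linarith) hδ0
    constructor <;> apply cancel
    · have a1 := h1 (s - δ) s (by linarith) (by linarith) (by linarith)
      have a2 := h3 (s - δ) s (by linarith) (by linarith) (by linarith)
      rw [reverseLoop_of_le heq le_rfl, reverseLoop_of_le heq (by linarith)] at a2
      rw [sub_sub_cancel] at a1 a2
      have e : δ • (T - U) = (γ s - γ (s - δ) - δ • U) - (γ s - γ (s - δ) - δ • T) := by
        rw [smul_sub]
        abel
      rw [e]
      exact (norm_sub_le _ _).trans (add_le_add a2 a1)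
    · have a1 := h2 (t - δ) t (by linarith) (by linarith) (by linarith)
      have a2 := h3 s (s + δ) (by linarith) (by linarith) (by linarith)
      rw [hrs, reverseLoop_of_mem ⟨by linarith, by linarith⟩,
        show s + t - (s + δ) = t - δ by ring, add_sub_cancel_left] at a2
      rw [sub_sub_cancel] at a1
      have e : δ • (T' + U) = -((γ t - γ (t - δ) - δ • T') + (γ (t - δ) - γ t - δ • U)) := by
        rw [smul_add]
        abel
      rw [e, norm_neg]
      exact (norm_add_le _ _).trans (add_le_add a1 a2)
  have hz1 : T - U = 0 := norm_le_zero_iff.1 (le_of_forall_pos_le_add fun ε hε => by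
    linarith [(hsmall (ε / 2) (by linarith)).1])
  have hz2 : T' + U = 0 := norm_le_zero_iff.1 (le_of_forall_pos_le_add fun ε hε => by
    linarith [(hsmall (ε / 2) (by linarith)).2])
  rw [sub_eq_zero.1 hz1]
  exact eq_neg_of_add_eq_zero_left hz2

end IsArcLengthMinimizer

end DoublePoints

/-! ### Tubular neighbourhoods in the plane -/

section Tubes

variable {μ : Measure (EuclideanSpace ℝ (Fin 2))} {γ : ℝ → EuclideanSpace ℝ (Fin 2)}

/-- Area of the `W`-neighbourhood of a planar curve: it is covered by `(b - a) / W + 1` balls of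
radius `2 W` centred on the curve. -/
lemma volume_cthickening_image_le {a b W : ℝ} (hab : a ≤ b) (hW : 0 < W)
    (hγ : LipschitzOnWith 1 γ (Icc a b)) :
    volume (Metric.cthickening W (γ '' Icc a b)) ≤
      ENNReal.ofReal (4 * Real.pi * W * (b - a + W)) := by
  set N := ⌊(b - a) / W⌋₊ with hN
  have hcomp : IsCompact (γ '' Icc a b) := isCompact_Icc.image_of_continuousOn hγ.continuousOn
  have hsub : Metric.cthickening W (γ '' Icc a b) ⊆
      ⋃ i ∈ Finset.range (N + 1), Metric.closedBall (γ (a + i * W)) (2 * W) := by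
    intro x hx
    rw [hcomp.cthickening_eq_biUnion_closedBall hW.le, mem_iUnion₂] at hx
    obtain ⟨_, ⟨τ, hτ, rfl⟩, hxτ⟩ := hx
    have h0 : 0 ≤ (τ - a) / W := div_nonneg (by linarith [hτ.1]) hW.le
    have h1 := Nat.floor_le h0
    have h2 := Nat.lt_floor_add_one ((τ - a) / W)
    rw [le_div_iff₀ hW] at h1
    rw [div_lt_iff₀ hW] at h2
    rw [mem_iUnion₂]
    refine ⟨⌊(τ - a) / W⌋₊, Finset.mem_range.2 (Nat.lt_succ_of_le (Nat.floor_le_floor ?_)), ?_⟩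
    · gcongr
      exact hτ.2
    have h3 : dist (γ τ) (γ (a + ⌊(τ - a) / W⌋₊ * W)) ≤ W := by
      refine (hγ.dist_le_mul τ hτ _ ⟨?_, by linarith [hτ.2]⟩).trans ?_
      · have : 0 ≤ (⌊(τ - a) / W⌋₊ : ℝ) * W := by positivity
        linarith
      · rw [NNReal.coe_one, one_mul, Real.dist_eq, abs_of_nonneg (by linarith)]
        linarith
    rw [Metric.mem_closedBall] at hxτ ⊢
    linarith [dist_triangle x (γ τ) (γ (a + ⌊(τ - a) / W⌋₊ * W))]
  calc volume (Metric.cthickening W (γ '' Icc a b))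
      ≤ ∑ i ∈ Finset.range (N + 1), volume (Metric.closedBall (γ (a + i * W)) (2 * W)) :=
        (measure_mono hsub).trans (measure_biUnion_finset_le _ _)
    _ = ENNReal.ofReal ((N + 1) * ((2 * W) ^ 2 * Real.pi)) := by
        simp only [EuclideanSpace.volume_closedBall_fin_two]
        rw [Finset.sum_const, Finset.card_range, nsmul_eq_mul, ← ENNReal.ofReal_pow (by positivity),
          ← ENNReal.ofReal_mul (by positivity), ← ENNReal.ofReal_natCast,
          ← ENNReal.ofReal_mul (by positivity), Nat.cast_add_one]
    _ ≤ _ := by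
        apply ENNReal.ofReal_le_ofReal
        have h1 := Nat.floor_le (div_nonneg (sub_nonneg.2 hab) hW.le)
        rw [← hN, le_div_iff₀ hW] at h1
        have := mul_le_mul_of_nonneg_left h1 (by positivity : 0 ≤ 4 * Real.pi * W)
        nlinarith

lemma volume_image_Icc_eq_zero {a b : ℝ} (hab : a ≤ b) (hγ : LipschitzOnWith 1 γ (Icc a b)) :
    volume (γ '' Icc a b) = 0 := by
  have hlim : Filter.Tendsto (fun W : ℝ => ENNReal.ofReal (4 * Real.pi * W * (b - a + W)))
      (nhdsWithin 0 (Ioi 0)) (nhds 0) := by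
    have hc : Continuous fun W : ℝ => ENNReal.ofReal (4 * Real.pi * W * (b - a + W)) :=
      ENNReal.continuous_ofReal.comp (by fun_prop)
    simpa using (hc.tendsto 0).mono_left nhdsWithin_le_nhds
  refine le_antisymm (ge_of_tendsto hlim ?_) bot_le
  filter_upwards [self_mem_nhdsWithin] with W hW
  exact (measure_mono (Metric.self_subset_cthickening _)).trans
    (volume_cthickening_image_le hab hW hγ)

lemma HasBoundedDensity.exists_le (h : HasBoundedDensity μ) [IsFiniteMeasure μ] :
    ∃ M : ℝ≥0, ∀ S, MeasurableSet S → μ S ≤ M * volume S := by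
  obtain ⟨hac, M, hM⟩ := h
  refine ⟨M, fun S hS => ?_⟩
  calc μ S = ∫⁻ x in S, μ.rnDeriv volume x := by
        conv_lhs => rw [← Measure.withDensity_rnDeriv_eq μ volume hac]
        rw [withDensity_apply _ hS]
    _ ≤ ∫⁻ _ in S, (M : ℝ≥0∞) := lintegral_mono_ae (ae_restrict_of_ae hM)
    _ = M * volume S := setLIntegral_const _ _

lemma measure_image_eq_zero {p L : ℝ} (hL : 0 ≤ L) (hdens : p < 2 → HasBoundedDensity μ)
    (hγ : LipschitzOnWith 1 γ (Icc 0 L)) (hp : p = 1) : μ (γ '' Icc 0 L) = 0 :=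
  (hdens (by linarith)).1 (volume_image_Icc_eq_zero hL hγ)

/-- The force exerted on a curve by the points within distance `W` is `O(W)`: for `p ≥ 2` because
the exponent `p - 1` is at least `1`, and for bounded densities because the area of the tube
is `O(W)`. -/
lemma exists_force_bound (hμ : IsDataMeasure μ) {p L : ℝ} (hp : 1 ≤ p)
    (hdens : p < 2 → HasBoundedDensity μ) (hγ : LipschitzOnWith 1 γ (Icc 0 L)) :
    ∃ B : ℝ, 0 ≤ B ∧ ∀ W ∈ Ioc (0 : ℝ) 1, ∀ a b, 0 ≤ a → a ≤ b → b ≤ L →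
      W ^ (p - 1) * μ.real (Metric.cthickening W (γ '' Icc a b)) ≤ B * W := by
  have := hμ.finite
  rcases lt_or_ge p 2 with h2 | h2
  · obtain ⟨M, hM⟩ := (hdens h2).exists_le
    refine ⟨M * (4 * Real.pi * (|L| + 1)), by positivity, fun W hW a b ha hab hb => ?_⟩
    have h3 : μ.real (Metric.cthickening W (γ '' Icc a b)) ≤
        M * (4 * Real.pi * W * (b - a + W)) := by
      refine ENNReal.toReal_le_of_le_ofReal
        (mul_nonneg M.2 (mul_nonneg (by have := hW.1; positivity) (by linarith [hW.1]))) ?_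
      rw [ENNReal.ofReal_mul M.coe_nonneg, ENNReal.ofReal_coe_nnreal]
      refine (hM _ Metric.isClosed_cthickening.measurableSet).trans ?_
      gcongr
      exact volume_cthickening_image_le hab hW.1 (hγ.mono (Icc_subset_Icc ha hb))
    have h4 : b - a + W ≤ |L| + 1 := by linarith [le_abs_self L, hW.2]
    calc W ^ (p - 1) * μ.real (Metric.cthickening W (γ '' Icc a b))
        ≤ 1 * μ.real (Metric.cthickening W (γ '' Icc a b)) := by
          gcongr
          exact Real.rpow_le_one hW.1.le hW.2 (by linarith)
      _ ≤ M * (4 * Real.pi * W * (|L| + 1)) := by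
          rw [one_mul]
          have := hW.1
          exact h3.trans (by gcongr)
      _ = _ := by ring
  · refine ⟨μ.real univ, measureReal_nonneg, fun W hW a b _ _ _ => ?_⟩
    rw [mul_comm]
    have h3 : W ^ (p - 1) ≤ W := by
      have := Real.rpow_le_rpow_of_exponent_ge hW.1 hW.2 (by linarith : 1 ≤ p - 1)
      rwa [Real.rpow_one] at this
    exact mul_le_mul (measureReal_mono (subset_univ _)) h3 (Real.rpow_nonneg hW.1.le _)
      measureReal_nonneg

end Tubes

/-! ### Two tangent arcs in the plane -/

section Arms

/-- `(e, n)` is an orthonormal frame of the plane. -/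
structure IsPlaneFrame (e n : EuclideanSpace ℝ (Fin 2)) : Prop where
  norm_left : ‖e‖ = 1
  norm_right : ‖n‖ = 1
  inner_eq_zero : inner ℝ e n = 0
  decomp : ∀ z : EuclideanSpace ℝ (Fin 2), z = (inner ℝ z e : ℝ) • e + (inner ℝ z n : ℝ) • n

lemma IsPlaneFrame.neg_right {e n : EuclideanSpace ℝ (Fin 2)} (h : IsPlaneFrame e n) :
    IsPlaneFrame e (-n) :=
  ⟨h.norm_left, by rw [norm_neg, h.norm_right], by rw [inner_neg_right, h.inner_eq_zero, neg_zero],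
    fun z => by
      rw [inner_neg_right, smul_neg, neg_smul, neg_neg]
      exact h.decomp z⟩

lemma IsPlaneFrame.norm_sq {e n : EuclideanSpace ℝ (Fin 2)} (h : IsPlaneFrame e n)
    (z : EuclideanSpace ℝ (Fin 2)) :
    ‖z‖ ^ 2 = (inner ℝ z e : ℝ) ^ 2 + (inner ℝ z n : ℝ) ^ 2 := by
  conv_lhs => rw [h.decomp z]
  rw [norm_add_sq_real, norm_smul, norm_smul, h.norm_left, h.norm_right, inner_smul_left,
    inner_smul_right, h.inner_eq_zero]
  simp

lemma exists_isPlaneFrame {e : EuclideanSpace ℝ (Fin 2)} (he : ‖e‖ = 1) :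
    ∃ n, IsPlaneFrame e n := by
  have h1 : e 0 ^ 2 + e 1 ^ 2 = 1 := by
    have := EuclideanSpace.real_norm_sq_eq e
    rw [he, Fin.sum_univ_two] at this
    linarith
  refine ⟨!₂[-e 1, e 0], he, ?_, ?_, fun z => ?_⟩
  · rw [EuclideanSpace.norm_eq, Fin.sum_univ_two, Real.sqrt_eq_one]
    simp only [Real.norm_eq_abs, sq_abs]
    simp
    linarith
  · simp [PiLp.inner_apply, Fin.sum_univ_two]
    ring
  · ext i
    fin_cases i
    · simp [PiLp.inner_apply, Fin.sum_univ_two]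
      linear_combination (-z 0) * h1
    · simp [PiLp.inner_apply, Fin.sum_univ_two]
      linear_combination (-z 1) * h1

/-- `α` is on `[0, h]` a nearly straight arc in the direction `e`. -/
def IsArm (α : ℝ → EuclideanSpace ℝ (Fin 2)) (e : EuclideanSpace ℝ (Fin 2)) (h : ℝ) : Prop :=
  ∀ a b, 0 ≤ a → a ≤ b → b ≤ h → ‖α b - α a - (b - a) • e‖ ≤ 1 / 2 * (b - a)

namespace IsArm

variable {α β : ℝ → EuclideanSpace ℝ (Fin 2)} {e n : EuclideanSpace ℝ (Fin 2)} {h : ℝ}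

lemma norm_sub_le (hα : IsArm α e h) (he : ‖e‖ = 1) {a b : ℝ} (ha : 0 ≤ a) (hab : a ≤ b)
    (hb : b ≤ h) : ‖α b - α a‖ ≤ 3 / 2 * (b - a) := by
  have h1 : ‖α b - α a‖ ≤ ‖(b - a) • e‖ + ‖α b - α a - (b - a) • e‖ :=
    norm_le_norm_add_norm_sub' _ _
  rw [norm_smul, he, Real.norm_of_nonneg (by linarith)] at h1
  linarith [hα a b ha hab hb]

lemma le_inner (hα : IsArm α e h) (he : ‖e‖ = 1) {a b : ℝ} (ha : 0 ≤ a) (hab : a ≤ b)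
    (hb : b ≤ h) : 1 / 2 * (b - a) ≤ inner ℝ (α b - α a) e := by
  have h1 := (abs_le.1 (abs_real_inner_le_norm (α b - α a - (b - a) • e) e)).1
  rw [inner_sub_left, real_inner_smul_left, real_inner_self_eq_norm_sq, he, mul_one] at h1
  linarith [hα a b ha hab hb]

lemma continuousOn (hα : IsArm α e h) (he : ‖e‖ = 1) : ContinuousOn α (Icc 0 h) := by
  have : LipschitzOnWith (3 / 2) α (Icc 0 h) := by
    refine LipschitzOnWith.of_dist_le_mul fun x hx y hy => ?_
    rw [dist_eq_norm, Real.dist_eq]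
    have e1 : ((3 / 2 : ℝ≥0) : ℝ) = 3 / 2 := by norm_num
    rw [e1]
    rcases le_total x y with hxy | hxy
    · rw [norm_sub_rev, abs_sub_comm, abs_of_nonneg (by linarith)]
      exact hα.norm_sub_le he hx.1 hxy hy.2
    · rw [abs_of_nonneg (by linarith)]
      exact hα.norm_sub_le he hy.1 hxy hx.2
  exact this.continuousOn

lemma eq_of_inner_eq (hα : IsArm α e h) (he : ‖e‖ = 1) {a b : ℝ} (ha : a ∈ Icc 0 h)
    (hb : b ∈ Icc 0 h) (hab : inner ℝ (α a - α 0) e = inner ℝ (α b - α 0) e) : a = b := by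
  have hz : inner ℝ (α a - α b) e = 0 := by
    rw [← sub_sub_sub_cancel_right (α a) (α b) (α 0), inner_sub_left, hab, sub_self]
  rcases le_total a b with h1 | h1
  · have := hα.le_inner he ha.1 h1 hb.2
    rw [← neg_sub (α a) (α b), inner_neg_left, hz] at this
    linarith
  · have := hα.le_inner he hb.1 h1 ha.2
    rw [hz] at this
    linarith

/-- An arm is a graph over the line in its direction: parametrization by the abscissa. -/
lemma exists_abscissa_param (hα : IsArm α e h) (he : ‖e‖ = 1) (hh : 0 ≤ h) :
    ∃ a : ℝ → ℝ, ContinuousOn a (Icc 0 (h / 2)) ∧ ∀ x ∈ Icc 0 (h / 2),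
      a x ∈ Icc 0 h ∧ inner ℝ (α (a x) - α 0) e = x := by
  have hc : ContinuousOn (fun r => inner ℝ (α r - α 0) e : ℝ → ℝ) (Icc 0 h) :=
    ((hα.continuousOn he).sub continuousOn_const).inner continuousOn_const
  have hex : ∀ x ∈ Icc 0 (h / 2), ∃ r ∈ Icc 0 h, inner ℝ (α r - α 0) e = x := by
    intro x hx
    refine intermediate_value_Icc hh hc ⟨?_, ?_⟩
    · simpa using hx.1
    · have := hα.le_inner he le_rfl hh le_rfl
      linarith [hx.2]
  choose! a ha hax using hex
  refine ⟨a, ?_, fun x hx => ⟨ha x hx, hax x hx⟩⟩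
  have hlip : LipschitzOnWith 2 a (Icc 0 (h / 2)) := by
    have key : ∀ x ∈ Icc 0 (h / 2), ∀ y ∈ Icc 0 (h / 2), a x ≤ a y →
        dist (a x) (a y) ≤ 2 * dist x y := by
      intro x hx y hy hxy
      have h1 := hα.le_inner he (ha x hx).1 hxy (ha y hy).2
      rw [← sub_sub_sub_cancel_right (α (a y)) (α (a x)) (α 0), inner_sub_left, hax x hx,
        hax y hy] at h1
      rw [dist_comm, dist_comm x, Real.dist_eq, Real.dist_eq, abs_of_nonneg (by linarith)]
      linarith [le_abs_self (y - x)]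
    refine LipschitzOnWith.of_dist_le_mul fun x hx y hy => ?_
    rcases le_total (a x) (a y) with hxy | hxy
    · exact key x hx y hy hxy
    · rw [dist_comm, dist_comm x]
      exact key y hy x hx hxy
  exact hlip.continuousOn

/-- Two arms that issue from the same point in the same direction and do not meet again lie on
either side of each other. Up to the choice of the normal `n`, the arm `α` lies above `β`, and
their vertical distance is largest at some abscissa. -/
lemma exists_widest (hα : IsArm α e h) (hβ : IsArm β e h) (he : ‖e‖ = 1) (hh : 0 < h)
    (h0 : α 0 = β 0) (hne : ∀ r ∈ Ioc 0 h, ∀ r' ∈ Ioc 0 h, α r ≠ β r') :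
    ∃ n, IsPlaneFrame e n ∧ ∃ ρ ∈ Ioc 0 h, ∃ ρ' ∈ Ioc 0 h, ∃ W : ℝ, 0 < W ∧ α ρ - β ρ' = W • n ∧
      (∀ r ∈ Ioo 0 ρ, ∃ r' ∈ Icc 0 h, ∃ w ∈ Ioc 0 W, α r - β r' = w • n) ∧
      (∀ r' ∈ Ioo 0 ρ', ∃ r ∈ Icc 0 h, ∃ w ∈ Ioc 0 W, α r - β r' = w • n) := by
  obtain ⟨a, hac, ha⟩ := hα.exists_abscissa_param he hh.le
  obtain ⟨b, hbc, hb⟩ := hβ.exists_abscissa_param he hh.le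
  have hzero : ∀ x ∈ Ioc 0 (h / 2), a x ∈ Ioc 0 h ∧ b x ∈ Ioc 0 h := by
    intro x hx
    obtain ⟨ha1, ha2⟩ := ha x (Ioc_subset_Icc_self hx)
    obtain ⟨hb1, hb2⟩ := hb x (Ioc_subset_Icc_self hx)
    refine ⟨⟨ha1.1.lt_of_ne ?_, ha1.2⟩, ⟨hb1.1.lt_of_ne ?_, hb1.2⟩⟩
    · intro h1
      rw [← h1, sub_self, inner_zero_left] at ha2
      linarith [hx.1]
    · intro h1
      rw [← h1, sub_self, inner_zero_left] at hb2
      linarith [hx.1]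
  have hhoriz : ∀ x ∈ Icc 0 (h / 2), inner ℝ (α (a x) - β (b x)) e = 0 := by
    intro x hx
    rw [← sub_sub_sub_cancel_right _ _ (α 0), inner_sub_left, (ha x hx).2, h0, (hb x hx).2,
      sub_self]
  have hcont : ∀ n : EuclideanSpace ℝ (Fin 2),
      ContinuousOn (fun x => inner ℝ (α (a x) - β (b x)) n : ℝ → ℝ)
      (Icc 0 (h / 2)) := fun n =>
    (((hα.continuousOn he).comp hac fun x hx => (ha x hx).1).sub
      ((hβ.continuousOn he).comp hbc fun x hx => (hb x hx).1)).inner continuousOn_const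
  obtain ⟨n, hn, hpos⟩ : ∃ n, IsPlaneFrame e n ∧
      ∀ x ∈ Ioc 0 (h / 2), 0 < (inner ℝ (α (a x) - β (b x)) n : ℝ) := by
    obtain ⟨m, hm⟩ := exists_isPlaneFrame he
    have hnz : ∀ x ∈ Ioc 0 (h / 2), (inner ℝ (α (a x) - β (b x)) m : ℝ) ≠ 0 := by
      intro x hx hx0
      have := hm.decomp (α (a x) - β (b x))
      rw [hx0, hhoriz x (Ioc_subset_Icc_self hx), zero_smul, zero_smul, add_zero] at this
      exact hne _ (hzero x hx).1 _ (hzero x hx).2 (sub_eq_zero.1 this)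
    have hc := (hcont m).mono (Ioc_subset_Icc_self : Ioc 0 (h / 2) ⊆ _)
    have hend : h / 2 ∈ Ioc 0 (h / 2) := ⟨by linarith, le_rfl⟩
    rcases lt_or_gt_of_ne (hnz _ hend) with hneg | hpos
    · refine ⟨-m, hm.neg_right, fun x hx => ?_⟩
      rw [inner_neg_right, neg_pos]
      by_contra hcon
      obtain ⟨y, hy, hy0⟩ := isPreconnected_Ioc.intermediate_value hend hx hc
        ⟨hneg.le, not_lt.1 hcon⟩
      exact hnz y hy hy0
    · refine ⟨m, hm, fun x hx => ?_⟩
      by_contra hcon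
      obtain ⟨y, hy, hy0⟩ := isPreconnected_Ioc.intermediate_value hx hend hc
        ⟨not_lt.1 hcon, hpos.le⟩
      exact hnz y hy hy0
  obtain ⟨x, hx, hmax⟩ := isCompact_Icc.exists_isMaxOn
    (nonempty_Icc.2 (by linarith : (0 : ℝ) ≤ h / 2)) (hcont n)
  have hmax : ∀ y ∈ Icc 0 (h / 2), (inner ℝ (α (a y) - β (b y)) n : ℝ) ≤
      inner ℝ (α (a x) - β (b x)) n := fun y hy => hmax hy
  have hWpos : 0 < (inner ℝ (α (a x) - β (b x)) n : ℝ) :=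
    (hpos _ ⟨by linarith, le_rfl⟩).trans_le (hmax (h / 2) ⟨by linarith, le_rfl⟩)
  have hxpos : 0 < x := by
    refine hx.1.lt_of_ne fun h1 => hWpos.ne' ?_
    have ha0 : a x = 0 := hα.eq_of_inner_eq he (ha x hx).1 ⟨le_rfl, hh.le⟩ (by
      rw [(ha x hx).2, sub_self, inner_zero_left, h1])
    have hb0 : b x = 0 := hβ.eq_of_inner_eq he (hb x hx).1 ⟨le_rfl, hh.le⟩ (by
      rw [(hb x hx).2, sub_self, inner_zero_left, h1])
    rw [ha0, hb0, h0, sub_self, inner_zero_left]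
  have hvert : ∀ y ∈ Icc 0 (h / 2),
      α (a y) - β (b y) = (inner ℝ (α (a y) - β (b y)) n : ℝ) • n := by
    intro y hy
    have := hn.decomp (α (a y) - β (b y))
    rwa [hhoriz y hy, zero_smul, zero_add] at this
  have hw : ∀ y ∈ Ioc 0 x, (inner ℝ (α (a y) - β (b y)) n : ℝ) ∈
      Ioc 0 (inner ℝ (α (a x) - β (b x)) n : ℝ) := fun y hy =>
    ⟨hpos y ⟨hy.1, hy.2.trans hx.2⟩, hmax y ⟨hy.1.le, hy.2.trans hx.2⟩⟩
  refine ⟨n, hn, a x, (hzero x ⟨hxpos, hx.2⟩).1, b x, (hzero x ⟨hxpos, hx.2⟩).2,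
    (inner ℝ (α (a x) - β (b x)) n : ℝ), hWpos, hvert x hx, fun r hr => ?_, fun r hr => ?_⟩
  · have hrh : r ≤ h := hr.2.le.trans (ha x hx).1.2
    set y := (inner ℝ (α r - α 0) e : ℝ) with hy
    have hy0 : 0 < y := by
      have := hα.le_inner he le_rfl hr.1.le hrh
      linarith [hr.1]
    have hyx : y ≤ x := by
      have := hα.le_inner he hr.1.le hr.2.le (ha x hx).1.2
      rw [← sub_sub_sub_cancel_right _ _ (α 0), inner_sub_left, (ha x hx).2] at this
      linarith [hr.2]
    have hyI : y ∈ Icc 0 (h / 2) := ⟨hy0.le, hyx.trans hx.2⟩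
    have har : a y = r := hα.eq_of_inner_eq he (ha y hyI).1 ⟨hr.1.le, hrh⟩ (ha y hyI).2
    refine ⟨b y, (hb y hyI).1, _, hw y ⟨hy0, hyx⟩, ?_⟩
    rw [← har]
    simpa only [har] using hvert y hyI
  · have hrh : r ≤ h := hr.2.le.trans (hb x hx).1.2
    set y := (inner ℝ (β r - β 0) e : ℝ) with hy
    have hy0 : 0 < y := by
      have := hβ.le_inner he le_rfl hr.1.le hrh
      linarith [hr.1]
    have hyx : y ≤ x := by
      have := hβ.le_inner he hr.1.le hr.2.le (hb x hx).1.2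
      rw [← sub_sub_sub_cancel_right _ _ (β 0), inner_sub_left, (hb x hx).2] at this
      linarith [hr.2]
    have hyI : y ∈ Icc 0 (h / 2) := ⟨hy0.le, hyx.trans hx.2⟩
    have hbr : b y = r := hβ.eq_of_inner_eq he (hb y hyI).1 ⟨hr.1.le, hrh⟩ (hb y hyI).2
    refine ⟨a y, (ha y hyI).1, _, hw y ⟨hy0, hyx⟩, ?_⟩
    simpa only [hbr] using hvert y hyI

/-- If a point has its foot on an arm, below which another point of the curve lies at vertical
distance at most `W`, and if the point itself lies on that lower side, then it is within `W` of
its foot: the segment to the foot is nearly vertical, so the other point would be closer. -/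
lemma norm_sub_le_of_foot (hα : IsArm α e h) (hf : IsPlaneFrame e n) {r : ℝ} (hr : r ∈ Ioo 0 h)
    {x q : EuclideanSpace ℝ (Fin 2)} (hfoot : ∀ r' ∈ Icc 0 h, ‖x - α r‖ ≤ ‖x - α r'‖)
    (hq : ‖x - α r‖ ≤ ‖x - q‖)
    {w : ℝ} (hw : 0 < w) (hqw : α r - q = w • n) (hside : inner ℝ (x - α r) n < 0) :
    ‖x - α r‖ ≤ w := by
  set z := x - α r with hz
  have he := hf.norm_left
  have hr' : ∀ r' ∈ Icc 0 h, 2 * inner ℝ z (α r' - α r) ≤ ‖α r' - α r‖ ^ 2 := by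
    intro r' hr'
    have h1 := hfoot r' hr'
    have h2 : x - α r' = z - (α r' - α r) := by
      rw [hz]
      abel
    rw [h2] at h1
    have h3 : ‖z‖ ^ 2 ≤ ‖z - (α r' - α r)‖ ^ 2 := by gcongr
    rw [norm_sub_sq_real z] at h3
    linarith
  have hz0 := norm_nonneg z
  have htan : |(inner ℝ z e : ℝ)| ≤ 1 / 2 * ‖z‖ := by
    refine le_of_forall_pos_le_add fun ε hε => ?_
    set τ := min (min r (h - r)) (ε / 2) with hτ
    have hτ0 : 0 < τ := lt_min (lt_min hr.1 (sub_pos.2 hr.2)) (by linarith)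
    have hτ1 : τ ≤ r := (min_le_left _ _).trans (min_le_left _ _)
    have hτ2 : τ ≤ h - r := (min_le_left _ _).trans (min_le_right _ _)
    have hτ3 : τ ≤ ε / 2 := min_le_right _ _
    have side : ∀ σ : ℝ, ∀ r' ∈ Icc 0 h, ‖α r' - α r - (σ * τ) • e‖ ≤ 1 / 2 * τ →
        ‖α r' - α r‖ ≤ 3 / 2 * τ → σ * inner ℝ z e ≤ 1 / 2 * ‖z‖ + ε := by
      intro σ r' hr'' h1 h2
      have h3 := (abs_le.1 (abs_real_inner_le_norm z (α r' - α r - (σ * τ) • e))).1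
      rw [inner_sub_right, real_inner_smul_right] at h3
      have h4 : ‖z‖ * ‖α r' - α r - (σ * τ) • e‖ ≤ ‖z‖ * (1 / 2 * τ) := by gcongr
      have h5 : ‖α r' - α r‖ ^ 2 ≤ (3 / 2 * τ) ^ 2 := by gcongr
      have h6 := hr' r' hr''
      have h7 : τ * (σ * inner ℝ z e) ≤ τ * (1 / 2 * ‖z‖ + ε) := by nlinarith
      exact le_of_mul_le_mul_left h7 hτ0
    rw [abs_le]
    constructor
    · have h1 := hα (r - τ) r (by linarith) (by linarith) hr.2.le
      have h2 := hα.norm_sub_le he (a := r - τ) (b := r) (by linarith) (by linarith) hr.2.le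
      rw [sub_sub_cancel] at h1 h2
      have := side (-1) (r - τ) ⟨by linarith, by linarith [hr.2]⟩ (by
        have e1 : α (r - τ) - α r - (-1 * τ) • e = -(α r - α (r - τ) - τ • e) := by
          rw [neg_one_mul, neg_smul]
          abel
        rwa [e1, norm_neg]) (by rwa [norm_sub_rev])
      linarith
    · have h1 := hα r (r + τ) hr.1.le (by linarith) (by linarith)
      have h2 := hα.norm_sub_le he (a := r) (b := r + τ) hr.1.le (by linarith) (by linarith)
      rw [add_sub_cancel_left] at h1 h2
      have := side 1 (r + τ) ⟨by linarith [hr.1], by linarith⟩ (by rwa [one_mul]) h2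
      linarith
  have hsq := hf.norm_sq z
  have h1 : (inner ℝ z e : ℝ) ^ 2 ≤ (1 / 2 * ‖z‖) ^ 2 := by
    rw [← sq_abs]
    gcongr
  have h2 : (inner ℝ z n : ℝ) ≤ -(1 / 2 * ‖z‖) := by
    by_contra hcon
    rw [not_le] at hcon
    nlinarith
  have h3 : x - q = z + w • n := by
    rw [← hqw, hz]
    abel
  have h4 : ‖z‖ ^ 2 ≤ ‖z + w • n‖ ^ 2 := by
    rw [← h3]
    gcongr
  rw [norm_add_sq_real, real_inner_smul_right, norm_smul, hf.norm_right, mul_one,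
    Real.norm_of_nonneg hw.le] at h4
  have h5 : 0 ≤ w * (2 * inner ℝ z n + w) := by linarith
  linarith [nonneg_of_mul_nonneg_right h5 hw]

end IsArm

end Arms

/-! ### Injectivity -/

section Injectivity

variable {μ : Measure (EuclideanSpace ℝ (Fin 2))} {lam p L : ℝ}
  {γ : ℝ → EuclideanSpace ℝ (Fin 2)}

/-- The field that moves the arm `[s - ρ, s]` by a multiple of `n` and the arm `[t, t + ρ']` by a
multiple of `-n`. Its coefficient climbs from `0` at the double point on the ramp of length `η`
and then descends with slope `-1`. -/
noncomputable def armField (s t ρ ρ' η : ℝ) (n : EuclideanSpace ℝ (Fin 2)) (τ : ℝ) :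
    EuclideanSpace ℝ (Fin 2) :=
  trapezoid (s - ρ) (s - η) (s - η) s τ • ((ρ - η) • n) +
    trapezoid t (t + η) (t + η) (t + ρ') τ • ((ρ' - η) • -n)

section armField

variable {s t ρ ρ' η : ℝ} {n : EuclideanSpace ℝ (Fin 2)}

lemma armField_of_le (hst : s < t) (hη : 0 < η) {τ : ℝ}
    (hτ : τ ≤ (s + t) / 2) :
    armField s t ρ ρ' η n τ = trapezoid (s - ρ) (s - η) (s - η) s τ • ((ρ - η) • n) := by
  rw [armField, trapezoid_of_le (a := t) (by linarith) (by linarith), zero_smul, add_zero]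

lemma armField_of_ge (hst : s < t) (hη : 0 < η) {τ : ℝ}
    (hτ : (s + t) / 2 ≤ τ) :
    armField s t ρ ρ' η n τ = trapezoid t (t + η) (t + η) (t + ρ') τ • ((ρ' - η) • -n) := by
  rw [armField, trapezoid_of_ge (d := s) (by linarith) (by linarith), zero_smul, zero_add]

lemma norm_armField_le (hn : ‖n‖ = 1) (hst : s < t) (hη : 0 < η) (hρ : η < ρ) (hρ' : η < ρ')
    {h₀ : ℝ} (hρh : ρ ≤ h₀) (hρh' : ρ' ≤ h₀) (τ : ℝ) : ‖armField s t ρ ρ' η n τ‖ ≤ h₀ := by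
  have key : ∀ φ c : ℝ, 0 ≤ φ → φ ≤ 1 → 0 ≤ c → c ≤ h₀ → φ * c ≤ h₀ := fun φ c h1 h2 h3 h4 =>
    (mul_le_of_le_one_left h3 h2).trans h4
  rcases le_total τ ((s + t) / 2) with hτ | hτ
  · rw [armField_of_le hst hη hτ, norm_smul, norm_smul, hn, mul_one,
      Real.norm_of_nonneg trapezoid_nonneg, Real.norm_of_nonneg (by linarith)]
    exact key _ _ trapezoid_nonneg trapezoid_le_one (by linarith) (by linarith)
  · rw [armField_of_ge hst hη hτ, norm_smul, norm_smul, norm_neg, hn, mul_one,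
      Real.norm_of_nonneg trapezoid_nonneg, Real.norm_of_nonneg (by linarith)]
    exact key _ _ trapezoid_nonneg trapezoid_le_one (by linarith) (by linarith)

/-- The unit slope of the descending ramps makes the first variation of length equal to minus the
gap `⟪γ (s - ρ) - γ (t + ρ'), n⟫` between the ends of the arms, up to the contributions of the
short ramps at the double point. -/
lemma lengthVariationLE_armField (hγ : LipschitzOnWith 1 γ (Icc 0 L)) (heq : γ s = γ t)
    (hst : s < t) (hη : 0 < η) (hρ : η < ρ) (hρ' : η < ρ') (hρs : ρ ≤ s) (hρt : t + ρ' ≤ L) :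
    LengthVariationLE γ (armField s t ρ ρ' η n) 0 L
      (-inner ℝ (γ (s - ρ) - γ (t + ρ')) n + ρ / η * inner ℝ (γ (s - η) - γ s) n
        - ρ' / η * inner ℝ (γ (t + η) - γ t) n) := by
  have h1 := lengthVariationLE_trapezoid (x := 0) (y := (s + t) / 2) (a := s - ρ) (b := s - η)
    (c := s - η) (d := s) (by linarith) (by linarith) le_rfl (by linarith) (by linarith)
    (hγ.mono (Icc_subset_Icc le_rfl (by linarith))) ((ρ - η) • n)
  have h2 := lengthVariationLE_trapezoid (x := (s + t) / 2) (y := L) (a := t) (b := t + η)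
    (c := t + η) (d := t + ρ') (by linarith) (by linarith) le_rfl (by linarith) (by linarith)
    (hγ.mono (Icc_subset_Icc (by linarith) le_rfl)) ((ρ' - η) • -n)
  have h3 := (h1.congr (w := armField s t ρ ρ' η n) fun τ hτ => armField_of_le hst hη hτ.2).trans
    (h2.congr (w := armField s t ρ ρ' η n) fun τ hτ => armField_of_ge hst hη hτ.1)
  convert h3 using 1
  have e1 : ρ - η ≠ 0 := by linarith
  have e2 : ρ' - η ≠ 0 := by linarith
  rw [show s - η - (s - ρ) = ρ - η by ring, show t + ρ' - (t + η) = ρ' - η by ring,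
    sub_sub_cancel, add_sub_cancel_left]
  simp only [inner_sub_left, real_inner_smul_right, inner_neg_right, heq]
  field_simp
  ring

end armField

namespace IsArcLengthMinimizer

/-- If `γ` is not injective, there is a double point with the largest parameter gap. -/
lemma exists_maximal_double_point (h : IsArcLengthMinimizer μ lam p L γ)
    (hinj : ¬ InjOn γ (Icc 0 L)) :
    ∃ s ∈ Icc 0 L, ∃ t ∈ Icc 0 L, s < t ∧ γ s = γ t ∧
      ∀ x ∈ Icc 0 L, ∀ y ∈ Icc 0 L, γ x = γ y → y - x ≤ t - s := by
  have hc : ContinuousOn (fun q : ℝ × ℝ => γ q.1 - γ q.2) (Icc 0 L ×ˢ Icc 0 L) :=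
    (h.lipschitz.continuousOn.comp continuousOn_fst fun q hq => hq.1).sub
      (h.lipschitz.continuousOn.comp continuousOn_snd fun q hq => hq.2)
  have hcl := hc.preimage_isClosed_of_isClosed (isClosed_Icc.prod isClosed_Icc)
    (isClosed_singleton (x := (0 : EuclideanSpace ℝ (Fin 2))))
  have hcomp := (isCompact_Icc.prod isCompact_Icc).of_isClosed_subset hcl inter_subset_left
  obtain ⟨a, ha, b, hb, hab, hne⟩ : ∃ a ∈ Icc 0 L, ∃ b ∈ Icc 0 L, γ a = γ b ∧ a < b := by
    simp only [InjOn, not_forall] at hinj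
    obtain ⟨a, ha, b, hb, hab, hne⟩ := hinj
    rcases lt_or_gt_of_ne hne with hlt | hlt
    · exact ⟨a, ha, b, hb, hab, hlt⟩
    · exact ⟨b, hb, a, ha, hab.symm, hlt⟩
  obtain ⟨⟨s, t⟩, ⟨hst, hst0⟩, hmax⟩ := hcomp.exists_isMaxOn
    ⟨(a, b), ⟨ha, hb⟩, by simp [hab]⟩
    (f := fun q : ℝ × ℝ => q.2 - q.1) (by fun_prop)
  have hmax' : ∀ x ∈ Icc 0 L, ∀ y ∈ Icc 0 L, γ x = γ y → y - x ≤ t - s :=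
    fun x hx y hy hxy => hmax (a := (x, y)) ⟨⟨hx, hy⟩, by simp [hxy]⟩
  exact ⟨s, hst.1, t, hst.2, by linarith [hmax' a ha b hb hab], sub_eq_zero.1 hst0, hmax'⟩

/-- The arms that continue the curve outwards from the loop between two parameters of a double
point, on a window shorter than any prescribed length. -/
lemma exists_isArm (h : IsArcLengthMinimizer μ lam p L γ) (hμ : IsDataMeasure μ)
    (hlam : 0 < lam) (hp : 1 ≤ p) (hΓ : p = 1 → μ (γ '' Icc 0 L) = 0) {s t : ℝ}
    (hs : 0 < s) (hst : s < t) (ht : t < L) (heq : γ s = γ t) {h₀ : ℝ} (hh₀ : 0 < h₀) :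
    ∃ e : EuclideanSpace ℝ (Fin 2), ‖e‖ = 1 ∧ HasTangentAt γ s (-e) ∧ HasTangentAt γ t e ∧
      ∃ δ > 0, δ < h₀ ∧ δ < s ∧ δ < L - t ∧
      IsArm (fun r => γ (s - r)) e δ ∧ IsArm (fun r => γ (t + r)) e δ := by
  have hsI : s ∈ Ioo 0 L := ⟨hs, hst.trans ht⟩
  have htI : t ∈ Ioo 0 L := ⟨hs.trans hst, ht⟩
  obtain ⟨T, hT⟩ := h.exists_hasTangentAt hμ hlam hp hΓ hsI (Ioo_subset_Icc_self htI) hst.ne heq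
  obtain ⟨T', hT'⟩ := h.exists_hasTangentAt hμ hlam hp hΓ htI (Ioo_subset_Icc_self hsI) hst.ne'
    heq.symm
  obtain rfl : T = -T' := by
    rw [h.tangent_eq_neg hμ hlam hp hΓ hs hst ht heq hT hT', neg_neg]
  refine ⟨T', h.norm_tangent hlam htI hT', hT, hT', ?_⟩
  obtain ⟨δ₁, hδ₁, h1⟩ := hT (1 / 2) (by norm_num)
  obtain ⟨δ₂, hδ₂, h2⟩ := hT' (1 / 2) (by norm_num)
  obtain ⟨δ, hδ0, hδ⟩ := exists_between (lt_min (lt_min hδ₁ hδ₂) (lt_min hh₀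
    (lt_min hs (sub_pos.2 ht))))
  simp only [lt_min_iff] at hδ
  refine ⟨δ, hδ0, hδ.2.1, hδ.2.2.1, hδ.2.2.2, fun a b ha hab hb => ?_, fun a b ha hab hb => ?_⟩
  · have := h1 (s - b) (s - a) (by linarith [hδ.1.1]) (by linarith) (by linarith)
    rw [show s - a - (s - b) = b - a by ring] at this
    have e1 : γ (s - b) - γ (s - a) - (b - a) • T' =
        -(γ (s - a) - γ (s - b) - (b - a) • -T') := by
      rw [smul_neg]
      abel
    rwa [e1, norm_neg]
  · have := h2 (t + a) (t + b) (by linarith) (by linarith) (by linarith [hδ.1.2])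
    rwa [show t + b - (t + a) = b - a by ring] at this

theorem injOn (h : IsArcLengthMinimizer μ lam p L γ) (hμ : IsDataMeasure μ)
    (hlam : 0 < lam) (hp : 1 ≤ p) (hdens : p < 2 → HasBoundedDensity μ) :
    InjOn γ (Icc 0 L) := by
  by_contra hinj
  have hΓ := measure_image_eq_zero h.nonneg hdens h.lipschitz
  obtain ⟨s, hsI, t, htI, hst, heq, hmax⟩ := h.exists_maximal_double_point hinj
  have hs : 0 < s := hsI.1.lt_of_ne fun h0 =>
    h.apply_zero_ne hμ hlam hp hΓ ⟨hsI.1.trans_lt hst, htI.2⟩ (by rw [h0]; exact heq)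
  have ht : t < L := htI.2.lt_of_ne fun h0 =>
    h.apply_right_ne hμ hlam hp hΓ ⟨hsI.1, hst.trans_le htI.2⟩ (by rw [← h0]; exact heq.symm)
  obtain ⟨B, hB0, hB⟩ := exists_force_bound hμ hp hdens h.lipschitz
  -- arms so short that the force on them cannot balance the gap between them
  obtain ⟨e, he, hTs, hTt, δ, hδ0, hδh, hδs, hδt, hα, hβ⟩ := h.exists_isArm hμ hlam hp hΓ hs hst ht
    heq (h₀ := min (1 / 3) (lam / (4 * p * B + 1))) (by positivity)
  have hδ3 : δ < 1 / 3 := hδh.trans_le (min_le_left _ _)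
  have hδB : δ * (4 * p * B + 1) < lam := by
    have := hδh.trans_le (min_le_right _ _)
    rwa [lt_div_iff₀ (by positivity)] at this
  obtain ⟨n, hf, ρ, hρ, ρ', hρ', W, hW, hgap, hα', hβ'⟩ := hα.exists_widest hβ he hδ0
    (by simpa using heq) (fun r hr r' hr' hrr => by
      have := hmax (s - r) ⟨by linarith [hr.2], by linarith [hr.1, hsI.2]⟩ (t + r')
        ⟨by linarith [hr'.1, htI.1], by linarith [hr'.2]⟩ hrr
      linarith [hr.1, hr'.1])
  have hn := hf.norm_right
  have hW1 : W ≤ 1 := by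
    have h1 : ‖γ (s - ρ) - γ (t + ρ')‖ = W := by
      rw [hgap, norm_smul, hn, mul_one, Real.norm_of_nonneg hW.le]
    have h2 := hα.norm_sub_le he le_rfl hρ.1.le hρ.2
    have h3 := hβ.norm_sub_le he le_rfl hρ'.1.le hρ'.2
    simp only [sub_zero, add_zero] at h2 h3
    have h4 : γ (s - ρ) - γ (t + ρ') = (γ (s - ρ) - γ s) - (γ (t + ρ') - γ t) := by
      rw [heq]
      abel
    rw [h4] at h1
    have := norm_sub_le (γ (s - ρ) - γ s) (γ (t + ρ') - γ t)
    linarith [hρ.2, hρ'.2]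
  -- a ramp length for which the length decreases at the rate of at least half of the gap
  obtain ⟨η, hη, hηρ, hηρ', hηD⟩ : ∃ η > 0, η < ρ ∧ η < ρ' ∧
      -inner ℝ (γ (s - ρ) - γ (t + ρ')) n + ρ / η * inner ℝ (γ (s - η) - γ s) n
        - ρ' / η * inner ℝ (γ (t + η) - γ t) n ≤ -(W / 2) := by
    obtain ⟨δ₁, hδ₁, h1⟩ := hTs (W / 4) (by positivity)
    obtain ⟨δ₂, hδ₂, h2⟩ := hTt (W / 4) (by positivity)
    obtain ⟨η, hη, hηlt⟩ := exists_between (lt_min (lt_min hδ₁ hδ₂) (lt_min hρ.1 hρ'.1))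
    simp only [lt_min_iff] at hηlt
    refine ⟨η, hη, hηlt.2.1, hηlt.2.2, ?_⟩
    have en : inner ℝ e n = 0 := hf.inner_eq_zero
    have b1 : inner ℝ (γ (s - η) - γ s) n ≤ W / 4 * η := by
      have a1 := h1 (s - η) s (by linarith [hηlt.1.1]) (by linarith) (by linarith)
      have a2 := (abs_le.1 (abs_real_inner_le_norm (γ s - γ (s - η) - (s - (s - η)) • -e) n)).1
      rw [hn, mul_one, inner_sub_left, real_inner_smul_left, inner_neg_left, en] at a2
      rw [sub_sub_cancel] at a1 a2
      rw [← neg_sub, inner_neg_left]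
      linarith
    have b2 : -(W / 4 * η) ≤ inner ℝ (γ (t + η) - γ t) n := by
      have a1 := h2 t (t + η) (by linarith) (by linarith) (by linarith [hηlt.1.2])
      have a2 := (abs_le.1 (abs_real_inner_le_norm (γ (t + η) - γ t - (t + η - t) • e) n)).1
      rw [hn, mul_one, inner_sub_left, real_inner_smul_left, en] at a2
      rw [add_sub_cancel_left] at a1 a2
      linarith
    have c1 : ρ / η * inner ℝ (γ (s - η) - γ s) n ≤ W / 4 := by
      calc ρ / η * inner ℝ (γ (s - η) - γ s) n ≤ ρ / η * (W / 4 * η) := by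
            have := div_nonneg hρ.1.le hη.le
            gcongr
        _ = ρ * (W / 4) := by field_simp
        _ ≤ W / 4 := mul_le_of_le_one_left (by positivity) (by linarith [hρ.2])
    have c2 : -(W / 4) ≤ ρ' / η * inner ℝ (γ (t + η) - γ t) n := by
      calc -(W / 4) ≤ -(ρ' * (W / 4)) :=
            neg_le_neg (mul_le_of_le_one_left (by positivity) (by linarith [hρ'.2]))
        _ = ρ' / η * -(W / 4 * η) := by field_simp
        _ ≤ _ := by
            have := div_nonneg hρ'.1.le hη.le
            gcongr
    have c3 : inner ℝ (γ (s - ρ) - γ (t + ρ')) n = W := by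
      rw [hgap, real_inner_smul_left, real_inner_self_eq_norm_sq, hn, one_pow, mul_one]
    linarith
  set S := Metric.cthickening W (γ '' Icc (s - ρ) s) ∪ Metric.cthickening W (γ '' Icc t (t + ρ'))
    with hS
  have hsubα : γ '' Icc (s - ρ) s ⊆ γ '' Icc 0 L :=
    image_mono (Icc_subset_Icc (by linarith [hρ.2]) hsI.2)
  have hsubβ : γ '' Icc t (t + ρ') ⊆ γ '' Icc 0 L :=
    image_mono (Icc_subset_Icc htI.1 (by linarith [hρ'.2]))
  have hfoot : ∀ x ∉ S, ∃ τ ∈ Icc 0 L, dist x (γ τ) = Metric.infDist x (γ '' Icc 0 L) ∧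
      0 ≤ inner ℝ (x - γ τ) (armField s t ρ ρ' η n τ) := by
    intro x hx
    rw [hS, mem_union, not_or] at hx
    obtain ⟨τ, hτ, hτx⟩ := h.exists_foot x
    have hle : ∀ u ∈ Icc 0 L, ‖x - γ τ‖ ≤ ‖x - γ u‖ := by
      intro u hu
      rw [← dist_eq_norm, ← dist_eq_norm, hτx]
      exact Metric.infDist_le_dist_of_mem (mem_image_of_mem γ hu)
    have hαI : ∀ r ∈ Icc 0 δ, s - r ∈ Icc 0 L := fun r hr =>
      ⟨by linarith [hr.2], by linarith [hr.1, hsI.2]⟩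
    have hβI : ∀ r ∈ Icc 0 δ, t + r ∈ Icc 0 L := fun r hr =>
      ⟨by linarith [hr.1, htI.1], by linarith [hr.2]⟩
    refine ⟨τ, hτ, hτx, ?_⟩
    rcases le_total τ ((s + t) / 2) with hm | hm
    · rw [armField_of_le hst hη hm, real_inner_smul_right, real_inner_smul_right]
      by_cases hin : τ ∈ Ioo (s - ρ) s
      · refine mul_nonneg trapezoid_nonneg (mul_nonneg (by linarith) ?_)
        by_contra hneg
        have hr : s - τ ∈ Ioo 0 ρ := ⟨by linarith [hin.2], by linarith [hin.1]⟩
        obtain ⟨r', hr', w, hw, hww⟩ := hα' (s - τ) hr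
        have := hα.norm_sub_le_of_foot hf ⟨hr.1, hr.2.trans_le hρ.2⟩ (x := x) (q := γ (t + r'))
          (fun u hu => by simpa only [sub_sub_cancel] using hle _ (hαI u hu))
          (by simpa only [sub_sub_cancel] using hle _ (hβI r' hr')) hw.1 hww
          (by simpa only [sub_sub_cancel] using not_le.1 hneg)
        simp only [sub_sub_cancel, ← dist_eq_norm] at this
        exact hx.1 (Metric.mem_cthickening_of_dist_le x (γ τ) W _
          (mem_image_of_mem γ ⟨hin.1.le, hin.2.le⟩) (this.trans hw.2))
      · have : trapezoid (s - ρ) (s - η) (s - η) s τ = 0 := by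
          rcases le_or_gt τ (s - ρ) with h1 | h1
          · exact trapezoid_of_le (by linarith) h1
          · exact trapezoid_of_ge (by linarith) (not_lt.1 fun h2 => hin ⟨h1, h2⟩)
        rw [this, zero_mul]
    · rw [armField_of_ge hst hη hm, real_inner_smul_right, real_inner_smul_right]
      by_cases hin : τ ∈ Ioo t (t + ρ')
      · refine mul_nonneg trapezoid_nonneg (mul_nonneg (by linarith) ?_)
        by_contra hneg
        have hr : τ - t ∈ Ioo 0 ρ' := ⟨by linarith [hin.1], by linarith [hin.2]⟩
        obtain ⟨r', hr', w, hw, hww⟩ := hβ' (τ - t) hr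
        have := hβ.norm_sub_le_of_foot hf.neg_right ⟨hr.1, hr.2.trans_le hρ'.2⟩ (x := x)
          (q := γ (s - r'))
          (fun u hu => by simpa only [add_sub_cancel] using hle _ (hβI u hu))
          (by simpa only [add_sub_cancel] using hle _ (hαI r' hr')) hw.1
          (by
            rw [smul_neg, ← hww]
            abel)
          (by simpa only [add_sub_cancel] using not_le.1 hneg)
        simp only [add_sub_cancel, ← dist_eq_norm] at this
        exact hx.2 (Metric.mem_cthickening_of_dist_le x (γ τ) W _
          (mem_image_of_mem γ ⟨hin.1.le, hin.2.le⟩) (this.trans hw.2))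
      · have : trapezoid t (t + η) (t + η) (t + ρ') τ = 0 := by
          rcases le_or_gt τ t with h1 | h1
          · exact trapezoid_of_le (by linarith) h1
          · exact trapezoid_of_ge (by linarith) (not_lt.1 fun h2 => hin ⟨h1, h2⟩)
        rw [this, zero_mul]
  have hR : ∀ x ∈ S, x ∈ μ.support → Metric.infDist x (γ '' Icc 0 L) ≤ W := by
    intro x hx _
    have key : ∀ a b, a ≤ b → γ '' Icc a b ⊆ γ '' Icc 0 L →
        x ∈ Metric.cthickening W (γ '' Icc a b) → Metric.infDist x (γ '' Icc 0 L) ≤ W := by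
      intro a b hab hsub hxa
      have hnon : (γ '' Icc a b).Nonempty := (nonempty_Icc.2 hab).image γ
      refine (Metric.infDist_le_infDist_of_subset hsub hnon).trans ?_
      exact ENNReal.toReal_le_of_le_ofReal hW.le (Metric.mem_cthickening_iff.1 hxa)
    rcases hx with hx | hx
    · exact key _ _ (by linarith [hρ.1]) hsubα hx
    · exact key _ _ (by linarith [hρ'.1]) hsubβ hx
  have hfv := h.first_variation hμ hlam.le hp hΓ
    (fun τ _ => norm_armField_le hn hst hη hηρ hηρ' hρ.2 hρ'.2 τ)
    (lengthVariationLE_armField (n := n) h.lipschitz heq hst hη hηρ hηρ' (by linarith [hρ.2])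
      (by linarith [hρ'.2]))
    (Metric.isClosed_cthickening.union Metric.isClosed_cthickening).measurableSet hR hfoot
  have hforce : W ^ (p - 1) * μ.real S ≤ 2 * B * W := by
    have h1 := hB W ⟨hW, hW1⟩ (s - ρ) s (by linarith [hρ.2]) (by linarith [hρ.1]) hsI.2
    have h2 := hB W ⟨hW, hW1⟩ t (t + ρ') htI.1 (by linarith [hρ'.1]) (by linarith [hρ'.2])
    have h3 := mul_le_mul_of_nonneg_left (measureReal_union_le (μ := μ)
      (Metric.cthickening W (γ '' Icc (s - ρ) s)) (Metric.cthickening W (γ '' Icc t (t + ρ'))))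
      (Real.rpow_nonneg hW.le (p - 1))
    linarith
  have h1 := mul_le_mul_of_nonneg_left hηD hlam.le
  have h2 := mul_le_mul_of_nonneg_left hforce (by positivity : 0 ≤ p * δ)
  have h3 : W * lam ≤ W * (4 * p * B * δ) := by linarith
  have h4 := le_of_mul_le_mul_left h3 hW
  linarith

end IsArcLengthMinimizer

end Injectivity

/-- In the plane, an arc-length-parameterized minimizer `γ : [0,L] → ℝ²` of `E_μ^{λ,p}` is
injective, and is a homeomorphism of `[0,L]` onto its image `Γ_γ`. -/
theorem theorem1p3 (μ : Measure (EuclideanSpace ℝ (Fin 2))) (hμ : IsDataMeasure μ)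
    (lam p : ℝ) (hlam : 0 < lam) (hp : 1 ≤ p)
    (hdens : p < 2 → HasBoundedDensity μ)
    (L : ℝ) (γ : ℝ → EuclideanSpace ℝ (Fin 2))
    (hγ : IsEnergyMinimizer μ lam p L γ)
    (harc : HasUnitSpeedOn γ (Icc 0 L)) :
    InjOn γ (Icc 0 L) ∧ Topology.IsEmbedding ((Icc 0 L).domRestrict γ) := by
  have h := hγ.isArcLengthMinimizer harc
  have hinj := h.injOn hμ hlam hp hdens
  have hcont : Continuous ((Icc 0 L).domRestrict γ) :=
    continuousOn_iff_continuous_domRestrict.1 h.lipschitz.continuousOn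
  exact ⟨hinj, (hcont.isClosedEmbedding (injOn_iff_injective.1 hinj)).isEmbedding⟩
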